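/- Let $\Sigma^+=\{(x,y)\in\mathbb R^2: x\ge 0,\ y\ge 0\}$, $\Sigma^-=\{x\le 0\}\cup\{x\ge 0,\ y\le 0\}$, and let $\Sigma=\Sigma^+\cap\Sigma^-$ be the nonregular line formed by the half-axes $\{x\ge0,\ y=0\}$ and $\{x=0,\ y\ge0\}$. Consider the discontinuous piecewise differential systems that have (i) in $\Sigma^-$ a linear differential center $$(L_c):\quad \dot x=-(A^2+\omega^2)y-Ax+B,\qquad \dot y=Ay+x+C,\qquad A,B,C\in\mathbb R,\ \omega>0,$$ possibly multiplied by a constant $\kappa\ne0$ (a constant change of the time scale; $\kappa=1$ is $(L_c)$ itself); (ii) in $\Sigma^+$ a system obtained by an affine change of variables $(x,y)\mapsto(a_1x+b_1y+c_1,\ \alpha_1x+\beta_1y+\gamma_1)$ with $b_1\alpha_1-a_1\beta_1\neq0$ from a member of one of the following six classes of Hamiltonian systems (referred to as the Hamiltonian nilpotent saddles $(N_1)$–$(N_6)$), with real parameters $a,b,c,\mu$: - $(N_1)$: $\dot x=ax+by$, $\dot y=-\frac{a^2}{b}x-ay+x^3$, with $b<0$; - $(N_2)$: $\dot x=ax+by-x^3$,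 $\dot y=-\frac{a^2}{b}x-ay+3x^2y$, with $a>0$, $b\ne0$; - $(N_3)$: $\dot x=ax+by-3x^2y+y^3$, $\dot y=\bigl(c-\frac{a^2}{b+c}\bigr)x-ay+3xy^2$, with either $a=b=0$, $c<0$ (subcase $N_3^1$), or $c=0$, $ab\ne0$, $\frac{a^2}{b}-6b>0$ (subcase $N_3^2$); - $(N_4)$: $\dot x=ax+by-3x^2y-y^3$, $\dot y=\bigl(c-\frac{a^2}{b+c}\bigr)x-ay+3xy^2$, with either $a=b=0$, $c>0$ ($N_4^1$), or $c=0$, $a\ne0$, $b<0$ ($N_4^2$); - $(N_5)$: $\dot x=ax+by-3\mu x^2y+y^3$, $\dot y=\bigl(c-\frac{a^2}{b+c}\bigr)x-ay+x^3+3\mu xy^2$, with either $a=b=0$, $c<0$ ($N_5^1$), or $c=0$, $b\ne0$, $\frac{a^4-b^4-6a^2b^2\mu}{b}>0$ ($N_5^2$); - $(N_6)$: $\dot x=ax+by-3\mu x^2y-y^3$, $\dot y=\bigl(c-\frac{a^2}{b+c}\bigr)x-ay+x^3+3\mu xy^2$, with either $a=b=0$, $c>0$ ($N_6^1$), or $c=0$,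 $b\ne0$, $\frac{a^4+b^4+6a^2b^2\mu}{b}<0$ ($N_6^2$). A *crossing periodic orbit* is a periodic orbit that meets $\Sigma$ in exactly two points $(x,0)$ and $(0,y)$ with $x,y>0$, at each of which the two vector fields are transversal to $\Sigma$ and point to the same side of it: it consists of one orbit arc of the system in $\Sigma^+$, whose interior lies in $\{x>0,\ y>0\}$, and one orbit arc of the system in $\Sigma^-$, whose interior lies in $\mathbb R^2\setminus\Sigma^+$. A *crossing limit cycle* is a crossing periodic orbit that is isolated, that is, it has a neighbourhood that contains no other crossing periodic orbit. Then every such system has at most seven crossing limit cycles. Moreover, for each of the ten cases $N_1$, $N_2$, $N_3^1$, $N_3^2$, $N_4^1$, $N_4^2$, $N_5^1$, $N_5^2$, $N_6^1$, $N_6^2$ there is such a system, with $\kappa=1$, that has exactly four crossing limit cycles. -/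

import Mathlib

namespace NilpotentPiecewise

/-- A vector field on the plane; the point `(x, y)` has coordinates `p.1 = x`, `p.2 = y`. -/
abbrev PlaneField := ℝ × ℝ → ℝ × ℝ

/-! The switching set -/

/-- The closed first quadrant. -/
def SigmaPlus : Set (ℝ × ℝ) := {p | 0 ≤ p.1 ∧ 0 ≤ p.2}

/-- The closure of the complement of the first quadrant. -/
def SigmaMinus : Set (ℝ × ℝ) := {p | p.1 ≤ 0} ∪ {p | 0 ≤ p.1 ∧ p.2 ≤ 0}

/-- The nonregular line: the nonnegative `x`- and `y`-half-axes. -/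
def Sigma : Set (ℝ × ℝ) := SigmaPlus ∩ SigmaMinus

theorem mem_plus_diff_iff (p : ℝ × ℝ) : p ∈ SigmaPlus \ Sigma ↔ 0 < p.1 ∧ 0 < p.2 := by
  simp only [Sigma, SigmaPlus, SigmaMinus, Set.mem_sdiff, Set.mem_inter_iff, Set.mem_union,
    Set.mem_ofPred_eq]
  grind

theorem mem_minus_diff_iff (p : ℝ × ℝ) : p ∈ SigmaMinus \ Sigma ↔ p.1 < 0 ∨ p.2 < 0 := by
  simp only [Sigma, SigmaPlus, SigmaMinus, Set.mem_sdiff, Set.mem_inter_iff, Set.mem_union,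
    Set.mem_ofPred_eq]
  grind

/-! The vector fields -/

/-- The linear center `ẋ = -(A² + ω²) y - A x + B`, `ẏ = A y + x + C` (with `ω > 0`). -/
def linearCenter (A B C ω : ℝ) : PlaneField :=
  fun p => (-(A ^ 2 + ω ^ 2) * p.2 - A * p.1 + B, A * p.2 + p.1 + C)

/-- The family `(N_1)`. -/
noncomputable def field1 (a b : ℝ) : PlaneField :=
  fun p => (a * p.1 + b * p.2, -(a ^ 2 / b) * p.1 - a * p.2 + p.1 ^ 3)

/-- The family `(N_2)`. -/
noncomputable def field2 (a b : ℝ) : PlaneField :=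
  fun p => (a * p.1 + b * p.2 - p.1 ^ 3, -(a ^ 2 / b) * p.1 - a * p.2 + 3 * p.1 ^ 2 * p.2)

/-- The family `(N_3)`. -/
noncomputable def field3 (a b c : ℝ) : PlaneField :=
  fun p => (a * p.1 + b * p.2 - 3 * p.1 ^ 2 * p.2 + p.2 ^ 3,
    (c - a ^ 2 / (b + c)) * p.1 - a * p.2 + 3 * p.1 * p.2 ^ 2)

/-- The family `(N_4)`. -/
noncomputable def field4 (a b c : ℝ) : PlaneField :=
  fun p => (a * p.1 + b * p.2 - 3 * p.1 ^ 2 * p.2 - p.2 ^ 3,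
    (c - a ^ 2 / (b + c)) * p.1 - a * p.2 + 3 * p.1 * p.2 ^ 2)

/-- The family `(N_5)`. -/
noncomputable def field5 (a b c μ : ℝ) : PlaneField :=
  fun p => (a * p.1 + b * p.2 - 3 * μ * p.1 ^ 2 * p.2 + p.2 ^ 3,
    (c - a ^ 2 / (b + c)) * p.1 - a * p.2 + p.1 ^ 3 + 3 * μ * p.1 * p.2 ^ 2)

/-- The family `(N_6)`. -/
noncomputable def field6 (a b c μ : ℝ) : PlaneField :=
  fun p => (a * p.1 + b * p.2 - 3 * μ * p.1 ^ 2 * p.2 - p.2 ^ 3,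
    (c - a ^ 2 / (b + c)) * p.1 - a * p.2 + p.1 ^ 3 + 3 * μ * p.1 * p.2 ^ 2)

/-- The labels of the classes: `(N_1)`, `(N_2)`, and `(N_3)`, ..., `(N_6)` with two subcases
each. -/
inductive SaddleClass
  | N1 | N2 | N31 | N32 | N41 | N42 | N51 | N52 | N61 | N62

/-- `F` is a vector field of the given class in normal form (before an affine change of
variables). -/
def IsNormalForm : SaddleClass → PlaneField → Prop
  | .N1, F => ∃ a b : ℝ, b < 0 ∧ F = field1 a b
  | .N2, F => ∃ a b : ℝ, 0 < a ∧ b ≠ 0 ∧ F = field2 a b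
  | .N31, F => ∃ c : ℝ, c < 0 ∧ F = field3 0 0 c
  | .N32, F => ∃ a b : ℝ, a * b ≠ 0 ∧ 0 < a ^ 2 / b - 6 * b ∧ F = field3 a b 0
  | .N41, F => ∃ c : ℝ, 0 < c ∧ F = field4 0 0 c
  | .N42, F => ∃ a b : ℝ, a ≠ 0 ∧ b < 0 ∧ F = field4 a b 0
  | .N51, F => ∃ c μ : ℝ, c < 0 ∧ F = field5 0 0 c μ
  | .N52, F => ∃ a b μ : ℝ, b ≠ 0 ∧ 0 < (a ^ 4 - b ^ 4 - 6 * a ^ 2 * b ^ 2 * μ) / b ∧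
      F = field5 a b 0 μ
  | .N61, F => ∃ c μ : ℝ, 0 < c ∧ F = field6 0 0 c μ
  | .N62, F => ∃ a b μ : ℝ, b ≠ 0 ∧ (a ^ 4 + b ^ 4 + 6 * a ^ 2 * b ^ 2 * μ) / b < 0 ∧
      F = field6 a b 0 μ

/-- The field `F` written in the new variables `(x, y)`, where the old variables are
`(a₁ x + b₁ y + c₁, α₁ x + β₁ y + γ₁)`: the inverse of the matrix `!![a₁, b₁; α₁, β₁]` applied to
the value of `F` at the old variables. -/
noncomputable def affineChange (a₁ b₁ c₁ α₁ β₁ γ₁ : ℝ) (F : PlaneField) : PlaneField :=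
  fun p =>
    let v := F (a₁ * p.1 + b₁ * p.2 + c₁, α₁ * p.1 + β₁ * p.2 + γ₁)
    ((β₁ * v.1 - b₁ * v.2) / (a₁ * β₁ - b₁ * α₁),
      (a₁ * v.2 - α₁ * v.1) / (a₁ * β₁ - b₁ * α₁))

/-- `Y` is obtained from a normal form of the class `s` by an affine change of variables. -/
def InClass (s : SaddleClass) (Y : PlaneField) : Prop :=
  ∃ (F : PlaneField) (a₁ b₁ c₁ α₁ β₁ γ₁ : ℝ), IsNormalForm s F ∧ b₁ * α₁ - a₁ * β₁ ≠ 0 ∧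
    Y = affineChange a₁ b₁ c₁ α₁ β₁ γ₁ F

/-! Crossing periodic orbits and crossing limit cycles of the piecewise system with the field `X`
in `SigmaMinus` and the field `Y` in `SigmaPlus` -/

/-- `S` is an orbit arc of the field `F` leading from `p` to `q` in positive time, which lies in
`U` except for its end points. -/
def IsArc (F : PlaneField) (U : Set (ℝ × ℝ)) (p q : ℝ × ℝ) (S : Set (ℝ × ℝ)) : Prop :=
  ∃ (T : ℝ) (γ : ℝ → ℝ × ℝ), 0 < T ∧
    (∀ t ∈ Set.Icc 0 T, HasDerivWithinAt γ (F (γ t)) (Set.Icc 0 T) t) ∧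
    γ 0 = p ∧ γ T = q ∧ (∀ t ∈ Set.Ioo 0 T, γ t ∈ U) ∧ S = γ '' Set.Icc 0 T

/-- A crossing point on the open `x`-half-axis: both fields cross the axis in the same direction. -/
def IsCrossingX (X Y : PlaneField) (p : ℝ × ℝ) : Prop :=
  0 < p.1 ∧ p.2 = 0 ∧ 0 < (X p).2 * (Y p).2

/-- A crossing point on the open `y`-half-axis. -/
def IsCrossingY (X Y : PlaneField) (q : ℝ × ℝ) : Prop :=
  q.1 = 0 ∧ 0 < q.2 ∧ 0 < (X q).1 * (Y q).1

/-- A crossing periodic orbit: a closed curve that meets the switching set at exactly two points,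
one crossing point on each open half-axis, made of an orbit arc of `Y` in the open quadrant and of
an orbit arc of `X` outside of the closed quadrant, run through in a common direction (the first
arc may start on either axis). -/
def IsCrossingPeriodicOrbit (X Y : PlaneField) (Γ : Set (ℝ × ℝ)) : Prop :=
  ∃ (p q : ℝ × ℝ) (S₁ S₂ : Set (ℝ × ℝ)),
    ((IsCrossingX X Y p ∧ IsCrossingY X Y q) ∨ (IsCrossingY X Y p ∧ IsCrossingX X Y q)) ∧
    IsArc Y (SigmaPlus \ Sigma) p q S₁ ∧ IsArc X (SigmaMinus \ Sigma) q p S₂ ∧ Γ = S₁ ∪ S₂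

/-- A crossing limit cycle: a crossing periodic orbit that is isolated among the crossing periodic
orbits. Near a crossing periodic orbit every periodic orbit is of this kind, since the crossings
are transversal. -/
def IsCrossingLimitCycle (X Y : PlaneField) (Γ : Set (ℝ × ℝ)) : Prop :=
  IsCrossingPeriodicOrbit X Y Γ ∧
    ∃ U : Set (ℝ × ℝ), IsOpen U ∧ Γ ⊆ U ∧
      ∀ Γ' : Set (ℝ × ℝ), IsCrossingPeriodicOrbit X Y Γ' → Γ' ⊆ U → Γ' = Γ

end NilpotentPiecewise

/-!
# Crossing limit cycles of a linear center and a Hamiltonian nilpotent saddle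

Both fields are Hamiltonian: the center has a quadratic first integral `L`, and an affine change of
variables turns the quartic Hamiltonian of a normal form into a quartic first integral `K` of the
other field. Hence the points `(x, 0)` and `(0, y)` of a crossing periodic orbit satisfy
`K (x, 0) = K (0, y)` and `L (x, 0) = L (0, y)`, and these two points determine the orbit, because
they determine its arcs.

*At most seven.* The second equation is a conic `x² + 2 C x = D y² - 2 B y` with `D > 0`, the first
one is a quartic curve, and both pass through the origin, so that by Bézout's theorem at most seven
other common points are isolated. This is elementary here (`encard_isolatedPoints_conic_le`): in
coordinates `u`, `v` along the asymptotes the conic is `u v = k`, which for `k ≠ 0` is parametrized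
by `u`, so that the common points are the roots of a polynomial of degree at most eight; for
`k = 0` there are two lines with at most four points each. What remains is that a limit cycle
yields an isolated common point, even if the two curves have a common component. This is shown by
perturbing a given orbit (`IsCrossingPeriodicOrbitAt.eventually_exists`): by continuous dependence
of the solutions on the initial value and transversality, each nearby common point carries a
crossing periodic orbit. The underlying stability statement for arcs is `IsArc.stable`. Its proof
replaces the field by one truncated outside of a square, which is Lipschitz and bounded, so that
its solutions exist for all times.

*Exactly four.* For the center `ẋ = -y`, `ẏ = x + 1 / 2` the conic is `x² + x = y²`, whose branch in
the open quadrant is `x = 1 / ((1 + s)² - 1)`, `y = (1 + s) x` with `s > 0`. On it the quartic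
equation is a polynomial equation of degree seven in `s`. Its coefficients have four sign changes
in the examples, so that Descartes' rule of signs allows at most four positive roots, and four roots
are found by the intermediate value theorem. Each root carries an orbit: outside of the quadrant the
orbits of the center are circular arcs (`exists_isArc_circle`), and inside of it both partial
derivatives of `K` are negative on a rectangle that contains all four candidates, which forces the
solutions to move monotonically from one half-axis to the other (`exists_isArc_of_monotone`).
The criterion is `encard_limitCycles_eq_four`.
-/

namespace NilpotentPiecewise

open Set Filter Topology

/-! ### Solution curves of planar fields -/

/-- `γ` solves `γ' = F ∘ γ` on `[0, T]`, with one-sided derivatives at the end points. -/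
def IsSolutionOn (F : PlaneField) (T : ℝ) (γ : ℝ → ℝ × ℝ) : Prop :=
  ∀ t ∈ Icc 0 T, HasDerivWithinAt γ (F (γ t)) (Icc 0 T) t

theorem IsSolutionOn.continuousOn {F : PlaneField} {T : ℝ} {γ : ℝ → ℝ × ℝ}
    (h : IsSolutionOn F T γ) : ContinuousOn γ (Icc 0 T) :=
  fun t ht => (h t ht).continuousWithinAt

theorem IsSolutionOn.mono {F : PlaneField} {T T' : ℝ} {γ : ℝ → ℝ × ℝ}
    (h : IsSolutionOn F T γ) (hT : T' ≤ T) : IsSolutionOn F T' γ :=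
  fun t ht => (h t ⟨ht.1, ht.2.trans hT⟩).mono (Icc_subset_Icc_right hT)

theorem IsSolutionOn.congr_field {F G : PlaneField} {T : ℝ} {γ : ℝ → ℝ × ℝ}
    (h : IsSolutionOn F T γ) (hFG : ∀ t ∈ Icc 0 T, F (γ t) = G (γ t)) : IsSolutionOn G T γ :=
  fun t ht => hFG t ht ▸ h t ht

theorem IsSolutionOn.hasDerivAt {F : PlaneField} {T : ℝ} {γ : ℝ → ℝ × ℝ}
    (h : IsSolutionOn F T γ) {t : ℝ} (ht : t ∈ Ioo 0 T) : HasDerivAt γ (F (γ t)) t :=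
  (h t (Ioo_subset_Icc_self ht)).hasDerivAt (Icc_mem_nhds ht.1 ht.2)

theorem IsSolutionOn.hasDerivWithinAt_Ici {F : PlaneField} {T : ℝ} {γ : ℝ → ℝ × ℝ}
    (h : IsSolutionOn F T γ) {t : ℝ} (ht : t ∈ Ico 0 T) :
    HasDerivWithinAt γ (F (γ t)) (Ici t) t :=
  (h t (Ico_subset_Icc_self ht)).mono_of_mem_nhdsWithin (Icc_mem_nhdsGE_of_mem ht)

/-- The derivative of a linear functional along a solution curve. -/
theorem IsSolutionOn.hasDerivAt_clm {F : PlaneField} {T : ℝ} {γ : ℝ → ℝ × ℝ}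
    (h : IsSolutionOn F T γ) (l : ℝ × ℝ →L[ℝ] ℝ) {t : ℝ} (ht : t ∈ Ioo 0 T) :
    HasDerivAt (fun s => l (γ s)) (l (F (γ t))) t :=
  l.hasFDerivAt.comp_hasDerivAt t (h.hasDerivAt ht)

theorem IsSolutionOn.strictMonoOn_clm {F : PlaneField} {T a b : ℝ} {γ : ℝ → ℝ × ℝ}
    (h : IsSolutionOn F T γ) (l : ℝ × ℝ →L[ℝ] ℝ) (ha : 0 ≤ a) (hb : b ≤ T)
    (hpos : ∀ t ∈ Ioo a b, 0 < l (F (γ t))) : StrictMonoOn (fun s => l (γ s)) (Icc a b) := by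
  refine strictMonoOn_of_hasDerivWithinAt_pos (f' := fun t => l (F (γ t))) (convex_Icc a b)
    (l.continuous.comp_continuousOn (h.continuousOn.mono (Icc_subset_Icc ha hb))) ?_ ?_
  · intro t ht
    rw [interior_Icc] at ht
    exact (h.hasDerivAt_clm l ⟨ha.trans_lt ht.1, ht.2.trans_le hb⟩).hasDerivWithinAt
  · intro t ht
    rw [interior_Icc] at ht
    exact hpos t ht

theorem IsSolutionOn.strictAntiOn_clm {F : PlaneField} {T a b : ℝ} {γ : ℝ → ℝ × ℝ}
    (h : IsSolutionOn F T γ) (l : ℝ × ℝ →L[ℝ] ℝ) (ha : 0 ≤ a) (hb : b ≤ T)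
    (hneg : ∀ t ∈ Ioo a b, l (F (γ t)) < 0) : StrictAntiOn (fun s => l (γ s)) (Icc a b) := by
  have := h.strictMonoOn_clm (-l) ha hb (fun t ht => by simpa using hneg t ht)
  intro s hs t ht hst
  simpa using this hs ht hst

/-- Time reversal of a solution curve. -/
theorem IsSolutionOn.reverse {F : PlaneField} {T : ℝ} {γ : ℝ → ℝ × ℝ}
    (h : IsSolutionOn F T γ) : IsSolutionOn (-F) T (fun t => γ (T - t)) := by
  intro t ht
  have h1 : HasDerivWithinAt (fun s : ℝ => T - s) (-1) (Icc 0 T) t :=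
    ((hasDerivAt_id t).const_sub T).hasDerivWithinAt
  have hmaps : MapsTo (fun s : ℝ => T - s) (Icc 0 T) (Icc 0 T) :=
    fun s hs => ⟨by linarith [hs.2], by linarith [hs.1]⟩
  have := (h (T - t) (hmaps ht)).scomp t h1 hmaps
  simpa [Function.comp_def] using this

/-! ### Truncated fields -/

/-- The nearest-point projection (coordinate by coordinate) onto the rectangle
`[a, b] × [c, d]`. -/
def clamp (a b c d : ℝ) (p : ℝ × ℝ) : ℝ × ℝ := (max a (min p.1 b), max c (min p.2 d))

theorem lipschitzWith_clamp (a b c d : ℝ) : LipschitzWith 1 (clamp a b c d) := by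
  have h1 := (LipschitzWith.prod_fst (α := ℝ) (β := ℝ)).min_const b |>.const_max a
  have h2 := (LipschitzWith.prod_snd (α := ℝ) (β := ℝ)).min_const d |>.const_max c
  simpa using! h1.prodMk h2

theorem clamp_eq_self {a b c d : ℝ} {p : ℝ × ℝ} (h1 : p.1 ∈ Icc a b) (h2 : p.2 ∈ Icc c d) :
    clamp a b c d p = p := by
  simp [clamp, h1.1, h1.2, h2.1, h2.2]

theorem clamp_mem {a b c d : ℝ} (hab : a ≤ b) (hcd : c ≤ d) (p : ℝ × ℝ) :
    clamp a b c d p ∈ Icc a b ×ˢ Icc c d := by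
  simp [clamp, hab, hcd]

theorem clamp_eq_self_of_norm_le {R : ℝ} {p : ℝ × ℝ} (h : ‖p‖ ≤ R) :
    clamp (-R) R (-R) R p = p := by
  have h1 := (norm_fst_le p).trans h
  have h2 := (norm_snd_le p).trans h
  rw [Real.norm_eq_abs, abs_le] at h1 h2
  exact clamp_eq_self h1 h2

/-- A locally Lipschitz field truncated outside of a rectangle is Lipschitz and bounded. -/
theorem exists_lipschitz_bound_clamp {F : PlaneField} (hF : LocallyLipschitz F) {a b c d : ℝ}
    (hab : a ≤ b) (hcd : c ≤ d) :
    ∃ K L : NNReal, LipschitzWith K (F ∘ clamp a b c d) ∧ ∀ p, ‖F (clamp a b c d p)‖ ≤ L := by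
  have hc : IsCompact (Icc a b ×ˢ Icc c d) := isCompact_Icc.prod isCompact_Icc
  obtain ⟨K, hK⟩ := hF.locallyLipschitzOn.exists_lipschitzOnWith_of_compact hc
  obtain ⟨L, hL⟩ := hc.exists_bound_of_continuousOn hF.continuous.continuousOn
  refine ⟨K, L.toNNReal, ?_, fun p => (hL _ (clamp_mem hab hcd p)).trans (Real.le_coe_toNNReal L)⟩
  have := hK.comp (lipschitzWith_clamp a b c d).lipschitzOnWith
    (s := univ) (fun p _ => clamp_mem hab hcd p)
  rw [mul_one, lipschitzOnWith_univ] at this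
  exact this

/-- Bounded Lipschitz fields have solutions over any compact time interval: the Picard-Lindelöf
theorem applies on a ball of radius `L T`, from which a solution cannot escape. -/
theorem exists_isSolutionOn {G : PlaneField} {K L : NNReal} (hK : LipschitzWith K G)
    (hL : ∀ p, ‖G p‖ ≤ L) {T : ℝ} (hT : 0 ≤ T) (p : ℝ × ℝ) :
    ∃ γ, γ 0 = p ∧ IsSolutionOn G T γ := by
  have hpl : IsPicardLindelof (fun _ => G) (⟨0, left_mem_Icc.2 hT⟩ : Icc 0 T) p
      (L * T.toNNReal) 0 L K :=
    { lipschitzOnWith := fun _ _ => hK.lipschitzOnWith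
      continuousOn := fun _ _ => continuousOn_const
      norm_le := fun _ _ x _ => hL x
      mul_max_le := by simp [hT] }
  obtain ⟨γ, h0, h1⟩ := hpl.exists_eq_forall_mem_Icc_hasDerivWithinAt₀
  exact ⟨γ, h0, h1⟩

/-! ### Orbit arcs: reversal, uniqueness, stability -/

theorem IsArc.reverse {F : PlaneField} {U S : Set (ℝ × ℝ)} {p q : ℝ × ℝ} (h : IsArc F U p q S) :
    IsArc (-F) U q p S := by
  obtain ⟨T, γ, hT, hγ, h0, h1, hU, rfl⟩ := h
  refine ⟨T, fun t => γ (T - t), hT, IsSolutionOn.reverse hγ, by simpa using h1, by simpa using h0,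
    fun t ht => hU _ ⟨by linarith [ht.2], by linarith [ht.1]⟩, ?_⟩
  rw [← image_image γ (fun t => T - t), image_const_sub_Icc]
  simp

theorem IsArc.mem_left {F : PlaneField} {U S : Set (ℝ × ℝ)} {p q : ℝ × ℝ}
    (h : IsArc F U p q S) : p ∈ S := by
  obtain ⟨T, γ, hT, -, h0, -, -, rfl⟩ := h
  exact ⟨0, left_mem_Icc.2 hT.le, h0⟩

theorem IsArc.mem_right {F : PlaneField} {U S : Set (ℝ × ℝ)} {p q : ℝ × ℝ}
    (h : IsArc F U p q S) : q ∈ S := by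
  obtain ⟨T, γ, hT, -, -, h1, -, rfl⟩ := h
  exact ⟨T, right_mem_Icc.2 hT.le, h1⟩

theorem IsArc.subset {F : PlaneField} {U S : Set (ℝ × ℝ)} {p q : ℝ × ℝ}
    (h : IsArc F U p q S) : S ⊆ insert p (insert q U) := by
  obtain ⟨T, γ, hT, -, h0, h1, hU, rfl⟩ := h
  rintro _ ⟨t, ht, rfl⟩
  rcases eq_or_lt_of_le ht.1 with h | h
  · left; rw [← h, h0]
  rcases eq_or_lt_of_le ht.2 with h' | h'
  · right; left; rw [h', h1]
  · right; right; exact hU t ⟨h, h'⟩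

/-- A field points into the side `l > 0` at the start of an arc which runs in that side. -/
theorem IsArc.start_nonneg {F : PlaneField} {U S : Set (ℝ × ℝ)} {p q : ℝ × ℝ}
    (h : IsArc F U p q S) (l : ℝ × ℝ →L[ℝ] ℝ) (hl : l p = 0)
    (hU : ∀ᶠ z in 𝓝 p, z ∈ U → 0 < l z) : 0 ≤ l (F p) := by
  obtain ⟨T, γ, hT, hγ, h0, -, hγU, -⟩ := h
  have hs : IsSolutionOn F T γ := hγ
  have hd : HasDerivWithinAt (fun s => l (γ s)) (l (F (γ 0))) (Ici 0) 0 :=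
    l.hasFDerivAt.comp_hasDerivWithinAt 0 (hs.hasDerivWithinAt_Ici ⟨le_rfl, hT⟩)
  rw [h0] at hd
  have hc : Tendsto γ (𝓝[>] 0) (𝓝 p) := by
    have := (hs.hasDerivWithinAt_Ici ⟨le_rfl, hT⟩).continuousWithinAt.tendsto
    rw [h0] at this
    exact this.mono_left (nhdsWithin_mono _ Ioi_subset_Ici_self)
  have hd' := (hasDerivWithinAt_iff_tendsto_slope' self_notMem_Ioi).1
    (hd.mono Ioi_subset_Ici_self)
  refine ge_of_tendsto hd' ?_
  filter_upwards [hc.eventually hU, Ioo_mem_nhdsGT hT] with t h1 h2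
  have := h1 (hγU t h2)
  simp only [slope_def_field, h0, hl, sub_zero]
  exact div_nonneg this.le h2.1.le

/-- An arc is determined by its starting point, as the end point is where it leaves `U`. -/
theorem IsArc.unique {F : PlaneField} (hF : LocallyLipschitz F) {U S S' : Set (ℝ × ℝ)}
    {p q q' : ℝ × ℝ} (h : IsArc F U p q S) (h' : IsArc F U p q' S') (hq : q ∉ U) (hq' : q' ∉ U) :
    S = S' := by
  have main : ∀ {T T' : ℝ} {γ γ' : ℝ → ℝ × ℝ}, 0 < T → IsSolutionOn F T γ → IsSolutionOn F T' γ' →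
      γ 0 = γ' 0 → T ≤ T' → (∀ t ∈ Ioo 0 T', γ' t ∈ U) → γ T ∉ U →
      γ '' Icc 0 T = γ' '' Icc 0 T' := by
    intro T T' γ γ' hT hγ hγ' h0 hTT hU hq
    have hγ'' := hγ'.mono hTT
    have hc : IsCompact (γ '' Icc 0 T ∪ γ' '' Icc 0 T) :=
      (isCompact_Icc.image_of_continuousOn hγ.continuousOn).union
        (isCompact_Icc.image_of_continuousOn hγ''.continuousOn)
    obtain ⟨K, hK⟩ := hF.locallyLipschitzOn.exists_lipschitzOnWith_of_compact hc
    have heq : EqOn γ γ' (Icc 0 T) :=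
      ODE_solution_unique_of_mem_Icc_right (v := fun _ => F) (s := fun _ => _) (fun _ _ => hK)
        hγ.continuousOn (fun t ht => hγ.hasDerivWithinAt_Ici ht)
        (fun t ht => Or.inl ⟨t, Ico_subset_Icc_self ht, rfl⟩)
        hγ''.continuousOn (fun t ht => hγ''.hasDerivWithinAt_Ici ht)
        (fun t ht => Or.inr ⟨t, Ico_subset_Icc_self ht, rfl⟩) h0
    have hT' : T = T' := by
      by_contra hne
      exact hq (heq (right_mem_Icc.2 hT.le) ▸ hU T ⟨hT, lt_of_le_of_ne hTT hne⟩)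
    rw [← hT']
    exact heq.image_eq
  obtain ⟨T, γ, hT, hγ, h0, h1, hU, rfl⟩ := h
  obtain ⟨T', γ', hT', hγ', h0', h1', hU', rfl⟩ := h'
  rcases le_total T T' with hTT | hTT
  · exact main hT hγ hγ' (h0.trans h0'.symm) hTT hU' (h1 ▸ hq)
  · exact (main hT' hγ' hγ (h0'.trans h0.symm) hTT hU (h1' ▸ hq')).symm

/-- Continuous dependence for a Lipschitz field, in the form of Grönwall's estimate. -/
theorem IsSolutionOn.dist_le {G : PlaneField} {K : NNReal} (hK : LipschitzWith K G) {T : ℝ}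
    {γ γ' : ℝ → ℝ × ℝ} (h : IsSolutionOn G T γ) (h' : IsSolutionOn G T γ') {t : ℝ}
    (ht : t ∈ Icc 0 T) : dist (γ t) (γ' t) ≤ dist (γ 0) (γ' 0) * Real.exp (K * T) := by
  have := dist_le_of_trajectories_ODE (v := fun _ => G) (fun _ => hK) h.continuousOn
    (fun t ht => h.hasDerivWithinAt_Ici ht) h'.continuousOn
    (fun t ht => h'.hasDerivWithinAt_Ici ht) le_rfl t ht
  refine this.trans (mul_le_mul_of_nonneg_left ?_ dist_nonneg)
  rw [Real.exp_le_exp, sub_zero]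
  exact mul_le_mul_of_nonneg_left ht.2 K.2

/-- Stability of transversal arcs: if an arc of `F` in `U` enters `U` transversally at `p` and
leaves it transversally at `q`, where near `p` and `q` the set `U` is a half plane, then from
every boundary point near `p` there starts an arc which stays close to the given one. -/
theorem IsArc.stable {F : PlaneField} (hF : LocallyLipschitz F) {U V W S : Set (ℝ × ℝ)}
    {p q : ℝ × ℝ} (hU : IsOpen U) (hS : IsArc F U p q S) {lp lq : ℝ × ℝ →L[ℝ] ℝ}
    (hp : ∀ᶠ z in 𝓝 p, 0 < lp z → z ∈ U) (hp' : 0 < lp (F p))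
    (hq : ∀ᶠ z in 𝓝 q, (z ∈ U ↔ 0 < lq z)) (hq0 : lq q = 0) (hq' : lq (F q) < 0)
    (hV : IsOpen V) (hSV : S ⊆ V) (hW : W ∈ 𝓝 q) :
    ∀ᶠ p' in 𝓝 p, 0 ≤ lp p' → ∃ q' ∈ W, lq q' = 0 ∧ ∃ S' ⊆ V, IsArc F U p' q' S' := by
  have hSp := hS.mem_left
  have hSq := hS.mem_right
  obtain ⟨T, γ, hT, hγ, h0, h1, hγU, rfl⟩ := hS
  have hγ : IsSolutionOn F T γ := hγ
  have hcomp : IsCompact (γ '' Icc 0 T) := isCompact_Icc.image_of_continuousOn hγ.continuousOn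
  -- A square whose interior contains the arc; `F` is truncated outside of it.
  obtain ⟨R, hR, hγR⟩ := hcomp.isBounded.subset_ball_lt 0 0
  obtain ⟨K, L, hK, hL⟩ := exists_lipschitz_bound_clamp hF (neg_le_self hR.le) (neg_le_self hR.le)
  set G : PlaneField := F ∘ clamp (-R) R (-R) R with hG
  have hGF : ∀ z ∈ Metric.ball (0 : ℝ × ℝ) R, G z = F z := by
    intro z hz
    rw [hG, Function.comp_apply, clamp_eq_self_of_norm_le (mem_ball_zero_iff.1 hz).le]
  have hV' : IsOpen (V ∩ Metric.ball 0 R) := hV.inter Metric.isOpen_ball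
  have hex : ∀ p', ∃ z, z 0 = p' ∧ IsSolutionOn G (T + 1) z :=
    fun p' => exists_isSolutionOn hK hL (by linarith) p'
  choose Φ hΦ0 hΦ using hex
  have hγG : IsSolutionOn G T γ :=
    hγ.congr_field fun t ht => (hGF _ (hγR ⟨t, ht, rfl⟩)).symm
  have heq : EqOn (Φ p) γ (Icc 0 T) := by
    intro t ht
    have := ((hΦ p).mono (by linarith : T ≤ T + 1)).dist_le hK hγG ht
    rw [hΦ0, h0, dist_self, zero_mul] at this
    exact dist_le_zero.1 this
  -- Balls around the end points on which `U` is a half plane crossed transversally by `G`.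
  have hGp : G p = F p := hGF p (hγR hSp)
  have hGq : G q = F q := hGF q (hγR hSq)
  have hGc : Continuous G := hK.continuous
  obtain ⟨ε₁, hε₁, hball₁⟩ := Metric.eventually_nhds_iff.1 ((hp.and
    ((lp.continuous.comp hGc).continuousAt.eventually_const_lt (u := 0) (by simpa [hGp]))).and
    (hV'.eventually_mem ⟨hSV hSp, hγR hSp⟩))
  obtain ⟨ε₂, hε₂, hball₂⟩ := Metric.eventually_nhds_iff.1 ((hq.and
    ((lq.continuous.comp hGc).continuousAt.eventually_lt_const (u := 0) (by simpa [hGq]))).and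
    ((hV'.eventually_mem ⟨hSV hSq, hγR hSq⟩).and (eventually_mem_set.2 hW)))
  have hTT : T ∈ Ioo 0 (T + 1) := ⟨hT, by linarith⟩
  -- The three stages of the motion: near `p`, in the open set `U`, and near `q`.
  obtain ⟨t₁, ht₁, hstart⟩ : ∃ t₁ ∈ Ioo 0 (T / 2), ∀ t ∈ Icc 0 t₁, dist (Φ p t) p < ε₁ / 2 := by
    have hc := ((hΦ p).continuousOn 0 ⟨le_rfl, by linarith⟩)
    have := hc.tendsto.eventually (Metric.ball_mem_nhds _ (half_pos hε₁))
    rw [hΦ0, nhdsWithin_Icc_eq_nhdsGE (by linarith), eventually_iff,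
      mem_nhdsGE_iff_exists_Icc_subset] at this
    obtain ⟨u, hu, hsub⟩ := this
    refine ⟨min u (T / 4), ⟨lt_min hu (by linarith), by linarith [min_le_right u (T / 4)]⟩, ?_⟩
    exact fun t ht => hsub ⟨ht.1, ht.2.trans (min_le_left _ _)⟩
  obtain ⟨t₂, ht₂, t₃, ht₃, hend⟩ : ∃ t₂ ∈ Ioo (T / 2) T, ∃ t₃ ∈ Ioo T (T + 1),
      ∀ t ∈ Icc t₂ t₃, dist (Φ p t) q < ε₂ / 2 := by
    have hc : ContinuousAt (Φ p) T := ((hΦ p).hasDerivAt hTT).continuousAt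
    have h2 : Φ p T = q := (heq (right_mem_Icc.2 hT.le)).trans h1
    have := hc.tendsto.eventually (Metric.ball_mem_nhds _ (half_pos hε₂))
    rw [h2, Metric.eventually_nhds_iff] at this
    obtain ⟨δ, hδ, hsub⟩ := this
    refine ⟨T - min (δ / 2) (T / 4), ⟨?_, ?_⟩, T + min (δ / 2) (1 / 2), ⟨?_, ?_⟩, ?_⟩
    · linarith [min_le_right (δ / 2) (T / 4)]
    · linarith [lt_min (half_pos hδ) (by linarith : 0 < T / 4)]
    · linarith [lt_min (half_pos hδ) (by norm_num : (0 : ℝ) < 1 / 2)]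
    · linarith [min_le_right (δ / 2) (1 / 2)]
    · intro t ht
      apply hsub
      rw [Real.dist_eq, abs_lt]
      constructor
      · linarith [ht.1, min_le_left (δ / 2) (T / 4)]
      · linarith [ht.2, min_le_left (δ / 2) (1 / 2)]
  obtain ⟨δ, hδ, hmid⟩ : ∃ δ > 0, ∀ t ∈ Icc t₁ t₂, ∀ z, dist z (Φ p t) < δ →
      z ∈ U ∩ (V ∩ Metric.ball 0 R) := by
    have hsub : Icc t₁ t₂ ⊆ Icc 0 T := Icc_subset_Icc ht₁.1.le ht₂.2.le
    have hc : IsCompact (Φ p '' Icc t₁ t₂) := isCompact_Icc.image_of_continuousOn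
      ((hΦ p).continuousOn.mono (hsub.trans (Icc_subset_Icc_right hTT.2.le)))
    obtain ⟨δ, hδ, h⟩ := hc.exists_thickening_subset_open (hU.inter hV') (by
      rintro _ ⟨t, ht, rfl⟩
      rw [heq (hsub ht)]
      exact ⟨hγU t ⟨ht₁.1.trans_le ht.1, ht.2.trans_lt ht₂.2⟩, hSV ⟨t, hsub ht, rfl⟩,
        hγR ⟨t, hsub ht, rfl⟩⟩)
    exact ⟨δ, hδ, fun t ht z hz => h (Metric.mem_thickening_iff.2 ⟨_, ⟨t, ht, rfl⟩, hz⟩)⟩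
  have hcross : lq (Φ p t₃) < 0 := by
    have hanti := (hΦ p).strictAntiOn_clm lq hT.le ht₃.2.le fun t ht =>
      (hball₂ ((hend t ⟨ht₂.2.le.trans ht.1.le, ht.2.le⟩).trans (half_lt_self hε₂))).1.2
    have := hanti (left_mem_Icc.2 ht₃.1.le) (right_mem_Icc.2 ht₃.1.le) ht₃.1
    simpa [heq (right_mem_Icc.2 hT.le), h1, hq0] using this
  obtain ⟨η, hη, hcross'⟩ := Metric.eventually_nhds_iff.1
    (lq.continuous.continuousAt.eventually_lt_const hcross)
  -- All starting points whose solutions stay close enough to the given one.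
  set E := Real.exp (K * (T + 1)) with hE
  have hE0 : 0 < E := Real.exp_pos _
  have hm : 0 < min (min (ε₁ / 2) (ε₂ / 2)) (min δ η) := by positivity
  filter_upwards [Metric.ball_mem_nhds p (div_pos hm hE0)] with p' hp'' hlp'
  have hclose : ∀ t ∈ Icc 0 (T + 1),
      dist (Φ p' t) (Φ p t) < min (min (ε₁ / 2) (ε₂ / 2)) (min δ η) := by
    intro t ht
    refine ((hΦ p').dist_le hK (hΦ p) ht).trans_lt ?_
    rw [hΦ0, hΦ0, ← lt_div_iff₀ hE0]
    exact hp''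
  have near_p : ∀ t ∈ Icc 0 t₁, dist (Φ p' t) p < ε₁ := by
    intro t ht
    have h2 := hclose t ⟨ht.1, by linarith [ht.2, ht₁.2]⟩
    have h3 := hstart t ht
    have h4 := dist_triangle (Φ p' t) (Φ p t) p
    have h5 := (h2.trans_le ((min_le_left _ _).trans (min_le_left _ _)))
    linarith
  have near_q : ∀ t ∈ Icc t₂ t₃, dist (Φ p' t) q < ε₂ := by
    intro t ht
    have h2 := hclose t ⟨by linarith [ht.1, ht₂.1], by linarith [ht.2, ht₃.2]⟩
    have h3 := hend t ht
    have h4 := dist_triangle (Φ p' t) (Φ p t) q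
    have h5 := (h2.trans_le ((min_le_left _ _).trans (min_le_right _ _)))
    linarith
  have near_mid : ∀ t ∈ Icc t₁ t₂, Φ p' t ∈ U ∩ (V ∩ Metric.ball 0 R) := fun t ht =>
    hmid t ht _ ((hclose t ⟨ht₁.1.le.trans ht.1, by linarith [ht.2, ht₂.2]⟩).trans_le
      ((min_le_right _ _).trans (min_le_left _ _)))
  have ht₁₂ : t₁ ≤ t₂ := by linarith [ht₁.2, ht₂.1]
  have ht₂₃ : t₂ ≤ t₃ := ht₂.2.le.trans ht₃.1.le
  have hmono := (hΦ p').strictMonoOn_clm lp le_rfl (b := t₁) (by linarith [ht₁.2]) fun t ht =>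
    (hball₁ (near_p t (Ioo_subset_Icc_self ht))).1.2
  have hanti := (hΦ p').strictAntiOn_clm lq (a := t₂) (by linarith [ht₂.1]) ht₃.2.le fun t ht =>
    (hball₂ (near_q t (Ioo_subset_Icc_self ht))).1.2
  have hpos : 0 < lq (Φ p' t₂) := (hball₂ (near_q t₂ (left_mem_Icc.2 ht₂₃))).1.1.1
    (near_mid t₂ (right_mem_Icc.2 ht₁₂)).1
  have hneg : lq (Φ p' t₃) < 0 := hcross' ((hclose t₃ ⟨by linarith [ht₃.1], ht₃.2.le⟩).trans_le
    ((min_le_right _ _).trans (min_le_right _ _)))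
  obtain ⟨τ, hτ, hτ0⟩ : (0 : ℝ) ∈ (fun s => lq (Φ p' s)) '' Icc t₂ t₃ :=
    intermediate_value_Icc' ht₂₃ (lq.continuous.comp_continuousOn ((hΦ p').continuousOn.mono
      (Icc_subset_Icc (by linarith [ht₂.1]) ht₃.2.le))) ⟨hneg.le, hpos.le⟩
  have hτpos : 0 < τ := by linarith [hτ.1, ht₂.1]
  have hstay : ∀ t ∈ Icc 0 τ, Φ p' t ∈ V ∩ Metric.ball 0 R := by
    intro t ht
    rcases le_total t t₁ with h | h
    · exact (hball₁ (near_p t ⟨ht.1, h⟩)).2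
    rcases le_total t t₂ with h' | h'
    · exact (near_mid t ⟨h, h'⟩).2
    · exact (hball₂ (near_q t ⟨h', ht.2.trans hτ.2⟩)).2.1
  refine ⟨Φ p' τ, (hball₂ (near_q τ hτ)).2.2, hτ0, Φ p' '' Icc 0 τ, ?_, τ, Φ p', hτpos, ?_, hΦ0 p',
    rfl, ?_, rfl⟩
  · rintro _ ⟨t, ht, rfl⟩
    exact (hstay t ht).1
  · exact ((hΦ p').mono (hτ.2.trans ht₃.2.le)).congr_field fun t ht => hGF _ (hstay t ht).2
  · intro t ht
    rcases le_total t t₁ with h | h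
    · refine (hball₁ (near_p t ⟨ht.1.le, h⟩)).1.1 ?_
      have := hmono ⟨le_rfl, ht₁.1.le⟩ ⟨ht.1.le, h⟩ ht.1
      simp only [hΦ0] at this
      exact hlp'.trans_lt this
    rcases le_total t t₂ with h' | h'
    · exact (near_mid t ⟨h, h'⟩).1
    · refine (hball₂ (near_q t ⟨h', ht.2.le.trans hτ.2⟩)).1.1.2 ?_
      have := hanti ⟨h', ht.2.le.trans hτ.2⟩ hτ ht.2
      simp only [hτ0] at this
      exact this

/-! ### Hamiltonian fields -/

/-- `F` is the Hamiltonian field `(∂H/∂y, -∂H/∂x)`. -/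
def IsHamiltonian (F : PlaneField) (H : ℝ × ℝ → ℝ) : Prop :=
  ∀ p, HasFDerivAt H
    ((F p).1 • ContinuousLinearMap.snd ℝ ℝ ℝ - (F p).2 • ContinuousLinearMap.fst ℝ ℝ ℝ) p

theorem IsHamiltonian.neg {F : PlaneField} {H : ℝ × ℝ → ℝ} (h : IsHamiltonian F H) :
    IsHamiltonian (-F) (-H) := by
  intro p
  convert! (h p).neg using 1
  ext <;> simp

/-- The Hamiltonian is a first integral. -/
theorem IsHamiltonian.const_of_isSolutionOn {F : PlaneField} {H : ℝ × ℝ → ℝ}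
    (h : IsHamiltonian F H) {T : ℝ} {γ : ℝ → ℝ × ℝ} (hγ : IsSolutionOn F T γ) {t : ℝ}
    (ht : t ∈ Icc 0 T) : H (γ t) = H (γ 0) := by
  refine constant_of_has_deriv_right_zero (f := H ∘ γ) ?_ ?_ t ht
  · exact (continuous_iff_continuousAt.2 fun p => (h p).continuousAt).comp_continuousOn
      hγ.continuousOn
  · intro s hs
    have := (h (γ s)).comp_hasDerivWithinAt s (hγ.hasDerivWithinAt_Ici hs)
    convert! this using 1
    simp [mul_comm]

theorem IsHamiltonian.eq_of_isArc {F : PlaneField} {H : ℝ × ℝ → ℝ} (h : IsHamiltonian F H)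
    {U S : Set (ℝ × ℝ)} {p q : ℝ × ℝ} (hS : IsArc F U p q S) : H p = H q := by
  obtain ⟨T, γ, hT, hγ, rfl, rfl, -, -⟩ := hS
  exact (h.const_of_isSolutionOn hγ (right_mem_Icc.2 hT.le)).symm

theorem IsHamiltonian.hasDerivAt_snd {F : PlaneField} {H : ℝ × ℝ → ℝ} (h : IsHamiltonian F H)
    (x y : ℝ) : HasDerivAt (fun t => H (x, t)) (F (x, y)).1 y := by
  have := (h (x, y)).comp_hasDerivAt y ((hasDerivAt_const y x).prodMk (hasDerivAt_id y))
  simpa [Function.comp_def] using this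

theorem IsHamiltonian.hasDerivAt_fst {F : PlaneField} {H : ℝ × ℝ → ℝ} (h : IsHamiltonian F H)
    (x y : ℝ) : HasDerivAt (fun t => H (t, y)) (-(F (x, y)).2) x := by
  have := (h (x, y)).comp_hasDerivAt x ((hasDerivAt_id x).prodMk (hasDerivAt_const x y))
  simpa [Function.comp_def] using this

/-- Near a point where a field crosses the `y`-axis, its Hamiltonian separates the points of the
axis. -/
theorem IsHamiltonian.exists_injOn_axis {F : PlaneField} {H : ℝ × ℝ → ℝ} (h : IsHamiltonian F H)
    (hF : Continuous F) {y : ℝ} (hy : (F (0, y)).1 ≠ 0) :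
    ∃ W ∈ 𝓝 y, InjOn (fun t => H (0, t)) W := by
  have hc : Continuous fun t : ℝ => (F (0, t)).1 :=
    continuous_fst.comp (hF.comp (Continuous.prodMk_right 0))
  obtain ⟨ε, hε, hball⟩ := Metric.eventually_nhds_iff_ball.1 (hc.continuousAt.eventually_ne hy)
  have key : ∀ s ∈ Metric.ball y ε, ∀ t ∈ Metric.ball y ε, s < t → H (0, s) ≠ H (0, t) := by
    intro s hs t ht hst heq
    obtain ⟨c, hc, hc0⟩ := exists_hasDerivAt_eq_zero hst
      (fun r _ => (h.hasDerivAt_snd 0 r).continuousAt.continuousWithinAt) heq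
      (fun r _ => h.hasDerivAt_snd 0 r)
    refine hball c ?_ hc0
    rw [Real.ball_eq_Ioo] at hs ht ⊢
    exact ⟨hs.1.trans hc.1, hc.2.trans ht.2⟩
  refine ⟨Metric.ball y ε, Metric.ball_mem_nhds y hε, fun s hs t ht hst => ?_⟩
  rcases lt_trichotomy s t with h' | h' | h'
  · exact absurd hst (key s hs t ht h')
  · exact h'
  · exact absurd hst.symm (key t ht s hs h')

/-! ### Crossing periodic orbits near a given one -/

/-- `U` is an open set which near the points of the two open half-axes is the half plane on the
side given by the sign of `σ`. Both components of the complement of `Sigma` are of this kind. -/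
structure IsSide (U : Set (ℝ × ℝ)) (σ : ℝ) : Prop where
  isOpen : IsOpen U
  ne_zero : σ ≠ 0
  near_x : ∀ x > 0, ∀ᶠ z in 𝓝 ((x, 0) : ℝ × ℝ), (z ∈ U ↔ 0 < σ * z.2)
  near_y : ∀ y > 0, ∀ᶠ z in 𝓝 ((0, y) : ℝ × ℝ), (z ∈ U ↔ 0 < σ * z.1)

theorem isSide_plus : IsSide (SigmaPlus \ Sigma) 1 where
  isOpen := by
    have : SigmaPlus \ Sigma = {p : ℝ × ℝ | 0 < p.1} ∩ {p | 0 < p.2} :=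
      Set.ext fun p => mem_plus_diff_iff p
    rw [this]
    exact (isOpen_lt continuous_const continuous_fst).inter
      (isOpen_lt continuous_const continuous_snd)
  ne_zero := one_ne_zero
  near_x x hx := by
    filter_upwards [continuous_fst.continuousAt.eventually_const_lt hx] with z hz
    rw [mem_plus_diff_iff]
    simp [hz]
  near_y y hy := by
    filter_upwards [continuous_snd.continuousAt.eventually_const_lt hy] with z hz
    rw [mem_plus_diff_iff]
    simp [hz]

theorem isSide_minus : IsSide (SigmaMinus \ Sigma) (-1) where
  isOpen := by
    have : SigmaMinus \ Sigma = {p : ℝ × ℝ | p.1 < 0} ∪ {p | p.2 < 0} :=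
      Set.ext fun p => mem_minus_diff_iff p
    rw [this]
    exact (isOpen_lt continuous_fst continuous_const).union
      (isOpen_lt continuous_snd continuous_const)
  ne_zero := by norm_num
  near_x x hx := by
    filter_upwards [continuous_fst.continuousAt.eventually_const_lt hx] with z hz
    rw [mem_minus_diff_iff]
    simp [hz.le]
  near_y y hy := by
    filter_upwards [continuous_snd.continuousAt.eventually_const_lt hy] with z hz
    rw [mem_minus_diff_iff]
    simp [hz.le]

theorem IsSide.notMem_x {U : Set (ℝ × ℝ)} {σ : ℝ} (h : IsSide U σ) {x : ℝ} (hx : 0 < x) :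
    ((x, 0) : ℝ × ℝ) ∉ U := by
  simpa using (h.near_x x hx).self_of_nhds

theorem IsSide.notMem_y {U : Set (ℝ × ℝ)} {σ : ℝ} (h : IsSide U σ) {y : ℝ} (hy : 0 < y) :
    ((0, y) : ℝ × ℝ) ∉ U := by
  simpa using (h.near_y y hy).self_of_nhds

/-- An arc from the `x`-axis to the `y`-axis enters `U` at its start. -/
theorem IsSide.start_pos {U S : Set (ℝ × ℝ)} {σ : ℝ} (h : IsSide U σ) {F : PlaneField} {x : ℝ}
    {q : ℝ × ℝ} (hx : 0 < x) (hS : IsArc F U (x, 0) q S) (hFx : (F (x, 0)).2 ≠ 0) :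
    0 < σ * (F (x, 0)).2 := by
  have := hS.start_nonneg (σ • ContinuousLinearMap.snd ℝ ℝ ℝ) (by simp)
    ((h.near_x x hx).mono fun z hz => by simpa using hz.1)
  exact lt_of_le_of_ne (by simpa using this) (mul_ne_zero h.ne_zero hFx).symm

/-- An arc to the `y`-axis leaves `U` at its end. -/
theorem IsSide.end_neg {U S : Set (ℝ × ℝ)} {σ : ℝ} (h : IsSide U σ) {F : PlaneField} {y : ℝ}
    {p : ℝ × ℝ} (hy : 0 < y) (hS : IsArc F U p (0, y) S) (hFy : (F (0, y)).1 ≠ 0) :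
    σ * (F (0, y)).1 < 0 := by
  have := hS.reverse.start_nonneg (σ • ContinuousLinearMap.fst ℝ ℝ ℝ) (by simp)
    ((h.near_y y hy).mono fun z hz => by simpa using hz.1)
  exact lt_of_le_of_ne (by simpa using this) (mul_ne_zero h.ne_zero hFy)

/-- Stability of transversal arcs from the `x`-axis to the `y`-axis, with the first integral used
to identify the new end point. -/
theorem IsSide.eventually_exists_isArc {U S V : Set (ℝ × ℝ)} {σ : ℝ} (h : IsSide U σ)
    {F : PlaneField} {H : ℝ × ℝ → ℝ} (hF : LocallyLipschitz F) (hH : IsHamiltonian F H) {x y : ℝ}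
    (hx : 0 < x) (hy : 0 < y) (hS : IsArc F U (x, 0) (0, y) S) (hFx : (F (x, 0)).2 ≠ 0)
    (hFy : (F (0, y)).1 ≠ 0) (hV : IsOpen V) (hSV : S ⊆ V) :
    ∀ᶠ z in 𝓝 ((x, y) : ℝ × ℝ), H (z.1, 0) = H (0, z.2) →
      ∃ S' ⊆ V, IsArc F U (z.1, 0) (0, z.2) S' := by
  obtain ⟨W, hW, hinj⟩ := hH.exists_injOn_axis hF.continuous hFy
  have hW' : Prod.snd ⁻¹' W ∈ 𝓝 ((0, y) : ℝ × ℝ) := continuousAt_snd.preimage_mem_nhds hW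
  have hstab := hS.stable hF h.isOpen (lp := σ • ContinuousLinearMap.snd ℝ ℝ ℝ)
    (lq := σ • ContinuousLinearMap.fst ℝ ℝ ℝ)
    ((h.near_x x hx).mono fun z hz => by simpa using hz.2)
    (by simpa using h.start_pos hx hS hFx) ((h.near_y y hy).mono fun z hz => by simpa using hz)
    (by simp) (by simpa using h.end_neg hy hS hFy) hV hSV hW'
  have ht : Tendsto (fun z : ℝ × ℝ => ((z.1, 0) : ℝ × ℝ)) (𝓝 (x, y)) (𝓝 (x, 0)) :=
    Continuous.tendsto' (by fun_prop) _ _ rfl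
  filter_upwards [ht.eventually hstab, continuousAt_snd.preimage_mem_nhds hW] with z hz hzW heq
  obtain ⟨⟨q₁, q₂⟩, hqW, hq, S', hS'V, hS'⟩ := hz (by simp)
  have hq₁ : q₁ = 0 := by simpa [h.ne_zero] using hq
  subst hq₁
  have : q₂ = z.2 := hinj hqW hzW ((hH.eq_of_isArc hS').symm.trans heq)
  subst this
  exact ⟨S', hS'V, hS'⟩

/-- `Γ` is a crossing periodic orbit through the points `(x, 0)` and `(0, y)`. -/
def IsCrossingPeriodicOrbitAt (X Y : PlaneField) (x y : ℝ) (Γ : Set (ℝ × ℝ)) : Prop :=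
  ∃ S₁ S₂ : Set (ℝ × ℝ), IsCrossingX X Y (x, 0) ∧ IsCrossingY X Y (0, y) ∧
    ((IsArc Y (SigmaPlus \ Sigma) (x, 0) (0, y) S₁ ∧
      IsArc X (SigmaMinus \ Sigma) (0, y) (x, 0) S₂) ∨
     (IsArc Y (SigmaPlus \ Sigma) (0, y) (x, 0) S₁ ∧
      IsArc X (SigmaMinus \ Sigma) (x, 0) (0, y) S₂)) ∧ Γ = S₁ ∪ S₂

section

variable {X Y : PlaneField} {x y x' y' : ℝ} {Γ Γ' : Set (ℝ × ℝ)}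

theorem isCrossingPeriodicOrbit_iff :
    IsCrossingPeriodicOrbit X Y Γ ↔ ∃ x y, IsCrossingPeriodicOrbitAt X Y x y Γ := by
  constructor
  · rintro ⟨⟨p₁, p₂⟩, ⟨q₁, q₂⟩, S₁, S₂, ⟨hp, hq⟩ | ⟨hp, hq⟩, h₁, h₂, rfl⟩
    · obtain rfl : p₂ = 0 := hp.2.1
      obtain rfl : q₁ = 0 := hq.1
      exact ⟨p₁, q₂, S₁, S₂, hp, hq, Or.inl ⟨h₁, h₂⟩, rfl⟩
    · obtain rfl : p₁ = 0 := hp.1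
      obtain rfl : q₂ = 0 := hq.2.1
      exact ⟨q₁, p₂, S₁, S₂, hq, hp, Or.inr ⟨h₁, h₂⟩, rfl⟩
  · rintro ⟨x, y, S₁, S₂, hx, hy, ⟨h₁, h₂⟩ | ⟨h₁, h₂⟩, rfl⟩
    · exact ⟨_, _, S₁, S₂, Or.inl ⟨hx, hy⟩, h₁, h₂, rfl⟩
    · exact ⟨_, _, S₁, S₂, Or.inr ⟨hy, hx⟩, h₁, h₂, rfl⟩

namespace IsCrossingPeriodicOrbitAt

theorem fst_pos (h : IsCrossingPeriodicOrbitAt X Y x y Γ) : 0 < x := by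
  obtain ⟨_, _, hx, -⟩ := h
  exact hx.1

theorem snd_pos (h : IsCrossingPeriodicOrbitAt X Y x y Γ) : 0 < y := by
  obtain ⟨_, _, -, hy, -⟩ := h
  exact hy.2.1

theorem mem_fst (h : IsCrossingPeriodicOrbitAt X Y x y Γ) : (x, 0) ∈ Γ := by
  obtain ⟨_, _, -, -, h | h, rfl⟩ := h
  · exact Or.inl h.1.mem_left
  · exact Or.inl h.1.mem_right

theorem mem_snd (h : IsCrossingPeriodicOrbitAt X Y x y Γ) : (0, y) ∈ Γ := by
  obtain ⟨_, _, -, -, h | h, rfl⟩ := h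
  · exact Or.inl h.1.mem_right
  · exact Or.inl h.1.mem_left

theorem subset (h : IsCrossingPeriodicOrbitAt X Y x y Γ) :
    Γ ⊆ {(x, 0), (0, y)} ∪ (SigmaPlus \ Sigma ∪ SigmaMinus \ Sigma) := by
  obtain ⟨_, _, -, -, h | h, rfl⟩ := h <;>
  · refine union_subset (h.1.subset.trans ?_) (h.2.subset.trans ?_) <;>
    · intro z
      simp only [mem_insert_iff, mem_union, mem_singleton_iff]
      tauto

theorem eq_of_mem_fst (h : IsCrossingPeriodicOrbitAt X Y x y Γ) (hx' : 0 < x')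
    (hmem : (x', 0) ∈ Γ) : x' = x := by
  rcases h.subset hmem with (h' | h') | h' | h'
  · exact congrArg Prod.fst h'
  · exact absurd (congrArg Prod.fst h') hx'.ne'
  · exact absurd h' (isSide_plus.notMem_x hx')
  · exact absurd h' (isSide_minus.notMem_x hx')

theorem eq_of_mem_snd (h : IsCrossingPeriodicOrbitAt X Y x y Γ) (hy' : 0 < y')
    (hmem : (0, y') ∈ Γ) : y' = y := by
  rcases h.subset hmem with (h' | h') | h' | h'
  · exact absurd (congrArg Prod.snd h') hy'.ne'
  · exact congrArg Prod.snd h'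
  · exact absurd h' (isSide_plus.notMem_y hy')
  · exact absurd h' (isSide_minus.notMem_y hy')

/-- There is at most one crossing periodic orbit through two given points; the direction in which
it is run through is the one in which the fields cross the `x`-axis. -/
theorem unique (hX : LocallyLipschitz X) (hY : LocallyLipschitz Y)
    (h : IsCrossingPeriodicOrbitAt X Y x y Γ) (h' : IsCrossingPeriodicOrbitAt X Y x y Γ') :
    Γ = Γ' := by
  have hx := h.fst_pos
  have hy := h.snd_pos
  have px := isSide_plus.notMem_x hx
  have py := isSide_plus.notMem_y hy
  have mx := isSide_minus.notMem_x hx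
  have my := isSide_minus.notMem_y hy
  obtain ⟨S₁, S₂, hcx, hcy, ho, rfl⟩ := h
  obtain ⟨S₁', S₂', -, -, ho', rfl⟩ := h'
  have hne : (Y (x, 0)).2 ≠ 0 := right_ne_zero_of_mul hcx.2.2.ne'
  have orient : ∀ {S S' : Set (ℝ × ℝ)}, IsArc Y (SigmaPlus \ Sigma) (x, 0) (0, y) S →
      IsArc Y (SigmaPlus \ Sigma) (0, y) (x, 0) S' → False := by
    intro S S' h₁ h₂
    have a := isSide_plus.start_pos hx h₁ hne
    have b := isSide_plus.start_pos hx h₂.reverse (by simpa using hne)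
    simp only [Pi.neg_apply, Prod.snd_neg] at b
    linarith
  rcases ho with ho | ho <;> rcases ho' with ho' | ho'
  · rw [ho.1.unique hY ho'.1 py py, ho.2.unique hX ho'.2 mx mx]
  · exact (orient ho.1 ho'.1).elim
  · exact (orient ho'.1 ho.1).elim
  · rw [ho.1.unique hY ho'.1 px px, ho.2.unique hX ho'.2 my my]

end IsCrossingPeriodicOrbitAt

end

/-- The pairs `(x, y)` such that `(x, 0)` and `(0, y)` are on common levels of both first
integrals. -/
def matchSet (K L : ℝ × ℝ → ℝ) : Set (ℝ × ℝ) :=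
  {z | K (z.1, 0) = K (0, z.2) ∧ L (z.1, 0) = L (0, z.2)}

theorem IsCrossingPeriodicOrbitAt.mem_matchSet {X Y : PlaneField} {L K : ℝ × ℝ → ℝ}
    (hL : IsHamiltonian X L) (hK : IsHamiltonian Y K) {x y : ℝ} {Γ : Set (ℝ × ℝ)}
    (h : IsCrossingPeriodicOrbitAt X Y x y Γ) : (x, y) ∈ matchSet K L := by
  obtain ⟨_, _, -, -, h | h, -⟩ := h
  · exact ⟨hK.eq_of_isArc h.1, (hL.eq_of_isArc h.2).symm⟩
  · exact ⟨(hK.eq_of_isArc h.1).symm, hL.eq_of_isArc h.2⟩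

/-- Close to a crossing periodic orbit, every pair of `matchSet` carries one. -/
theorem IsCrossingPeriodicOrbitAt.eventually_exists {X Y : PlaneField} {L K : ℝ × ℝ → ℝ}
    (hX : LocallyLipschitz X) (hY : LocallyLipschitz Y) (hL : IsHamiltonian X L)
    (hK : IsHamiltonian Y K) {x y : ℝ} {Γ V : Set (ℝ × ℝ)}
    (h : IsCrossingPeriodicOrbitAt X Y x y Γ) (hV : IsOpen V) (hΓ : Γ ⊆ V) :
    ∀ᶠ z in 𝓝 ((x, y) : ℝ × ℝ), z ∈ matchSet K L →
      ∃ Γ' ⊆ V, IsCrossingPeriodicOrbitAt X Y z.1 z.2 Γ' := by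
  obtain ⟨S₁, S₂, hcx, hcy, ho, rfl⟩ := h
  have hx : 0 < x := hcx.1
  have hy : 0 < y := hcy.2.1
  have hXx : (X (x, 0)).2 ≠ 0 := left_ne_zero_of_mul hcx.2.2.ne'
  have hYx : (Y (x, 0)).2 ≠ 0 := right_ne_zero_of_mul hcx.2.2.ne'
  have hXy : (X (0, y)).1 ≠ 0 := left_ne_zero_of_mul hcy.2.2.ne'
  have hYy : (Y (0, y)).1 ≠ 0 := right_ne_zero_of_mul hcy.2.2.ne'
  have hXc := hX.continuous
  have hYc := hY.continuous
  have hax : Continuous fun z : ℝ × ℝ => ((z.1, 0) : ℝ × ℝ) := by fun_prop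
  have hay : Continuous fun z : ℝ × ℝ => ((0, z.2) : ℝ × ℝ) := by fun_prop
  have ecx : ∀ᶠ z in 𝓝 ((x, y) : ℝ × ℝ), IsCrossingX X Y (z.1, 0) := by
    have h1 : ∀ᶠ z in 𝓝 ((x, y) : ℝ × ℝ), 0 < z.1 :=
      continuousAt_fst.eventually_const_lt (by exact hx)
    have h2 : ∀ᶠ z in 𝓝 ((x, y) : ℝ × ℝ), 0 < (X (z.1, 0)).2 * (Y (z.1, 0)).2 :=
      (((continuous_snd.comp (hXc.comp hax)).mul
        (continuous_snd.comp (hYc.comp hax))).continuousAt).eventually_const_lt (by exact hcx.2.2)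
    filter_upwards [h1, h2] with z h1 h2 using ⟨h1, rfl, h2⟩
  have ecy : ∀ᶠ z in 𝓝 ((x, y) : ℝ × ℝ), IsCrossingY X Y (0, z.2) := by
    have h1 : ∀ᶠ z in 𝓝 ((x, y) : ℝ × ℝ), 0 < z.2 :=
      continuousAt_snd.eventually_const_lt (by exact hy)
    have h2 : ∀ᶠ z in 𝓝 ((x, y) : ℝ × ℝ), 0 < (X (0, z.2)).1 * (Y (0, z.2)).1 :=
      (((continuous_fst.comp (hXc.comp hay)).mul
        (continuous_fst.comp (hYc.comp hay))).continuousAt).eventually_const_lt (by exact hcy.2.2)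
    filter_upwards [h1, h2] with z h1 h2 using ⟨rfl, h1, h2⟩
  have hnegX : LocallyLipschitz (-X) := hX.neg
  have hnegY : LocallyLipschitz (-Y) := hY.neg
  obtain ⟨hΓ₁, hΓ₂⟩ := union_subset_iff.1 hΓ
  rcases ho with ⟨h₁, h₂⟩ | ⟨h₁, h₂⟩
  · have e₁ := isSide_plus.eventually_exists_isArc hY hK hx hy h₁ hYx hYy hV hΓ₁
    have e₂ := isSide_minus.eventually_exists_isArc hnegX hL.neg hx hy h₂.reverse
      (by simpa using hXx) (by simpa using hXy) hV hΓ₂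
    filter_upwards [ecx, ecy, e₁, e₂] with z hzx hzy he₁ he₂ hz
    obtain ⟨S₁', hs₁, ha₁⟩ := he₁ hz.1
    obtain ⟨S₂', hs₂, ha₂⟩ := he₂ (by simpa using hz.2)
    exact ⟨S₁' ∪ S₂', union_subset hs₁ hs₂, S₁', S₂', hzx, hzy,
      Or.inl ⟨ha₁, by simpa using ha₂.reverse⟩, rfl⟩
  · have e₁ := isSide_plus.eventually_exists_isArc hnegY hK.neg hx hy h₁.reverse
      (by simpa using hYx) (by simpa using hYy) hV hΓ₁
    have e₂ := isSide_minus.eventually_exists_isArc hX hL hx hy h₂ hXx hXy hV hΓ₂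
    filter_upwards [ecx, ecy, e₁, e₂] with z hzx hzy he₁ he₂ hz
    obtain ⟨S₁', hs₁, ha₁⟩ := he₁ (by simpa using hz.1)
    obtain ⟨S₂', hs₂, ha₂⟩ := he₂ hz.2
    exact ⟨S₁' ∪ S₂', union_subset hs₁ hs₂, S₁', S₂', hzx, hzy,
      Or.inr ⟨by simpa using ha₁.reverse, ha₂⟩, rfl⟩

/-- The isolated points of a planar set. -/
def isolatedPoints (Z : Set (ℝ × ℝ)) : Set (ℝ × ℝ) :=
  {z | z ∈ Z ∧ ∀ᶠ w in 𝓝[≠] z, w ∉ Z}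

/-- A crossing limit cycle gives an isolated point of `matchSet`. -/
theorem IsCrossingPeriodicOrbitAt.mem_isolatedPoints {X Y : PlaneField} {L K : ℝ × ℝ → ℝ}
    (hX : LocallyLipschitz X) (hY : LocallyLipschitz Y) (hL : IsHamiltonian X L)
    (hK : IsHamiltonian Y K) {x y : ℝ} {Γ : Set (ℝ × ℝ)}
    (h : IsCrossingPeriodicOrbitAt X Y x y Γ) (hΓ : IsCrossingLimitCycle X Y Γ) :
    (x, y) ∈ isolatedPoints (matchSet K L) := by
  refine ⟨h.mem_matchSet hL hK, ?_⟩
  obtain ⟨-, V, hV, hΓV, hiso⟩ := hΓ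
  rw [eventually_nhdsWithin_iff]
  filter_upwards [h.eventually_exists hX hY hL hK hV hΓV] with z hz hne hmem
  obtain ⟨Γ', hΓ'V, hΓ'⟩ := hz hmem
  have heq := hiso Γ' (isCrossingPeriodicOrbit_iff.2 ⟨_, _, hΓ'⟩) hΓ'V
  rw [heq] at hΓ'
  exact hne (Prod.ext (h.eq_of_mem_fst hΓ'.fst_pos hΓ'.mem_fst)
    (h.eq_of_mem_snd hΓ'.snd_pos hΓ'.mem_snd))

/-- Crossing limit cycles are counted by isolated points of `matchSet` in the open quadrant. -/
theorem encard_limitCycles_le {X Y : PlaneField} {L K : ℝ × ℝ → ℝ}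
    (hX : LocallyLipschitz X) (hY : LocallyLipschitz Y) (hL : IsHamiltonian X L)
    (hK : IsHamiltonian Y K) :
    {Γ | IsCrossingLimitCycle X Y Γ}.encard ≤
      (isolatedPoints (matchSet K L) ∩ {z | 0 < z.1}).encard := by
  have hex : ∀ Γ : {Γ | IsCrossingLimitCycle X Y Γ}, ∃ z : ℝ × ℝ,
      IsCrossingPeriodicOrbitAt X Y z.1 z.2 Γ.1 := by
    intro Γ
    obtain ⟨x, y, h⟩ := isCrossingPeriodicOrbit_iff.1 Γ.2.1
    exact ⟨(x, y), h⟩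
  choose φ hφ using hex
  have hinj : Function.Injective φ := by
    intro Γ Γ' h
    have h' := hφ Γ'
    rw [← h] at h'
    exact Subtype.ext ((hφ Γ).unique hX hY h')
  have hsub : range φ ⊆ isolatedPoints (matchSet K L) ∩ {z | 0 < z.1} := by
    rintro _ ⟨Γ, rfl⟩
    exact ⟨(hφ Γ).mem_isolatedPoints hX hY hL hK Γ.2, (hφ Γ).fst_pos⟩
  refine le_trans ?_ (encard_le_encard hsub)
  rw [← image_univ, hinj.encard_image, encard_univ, ENat.card_coe_set_eq]

/-! ### Isolated intersections of a conic and a quartic -/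

section

open Polynomial

/-- Isolated points of `Z` on a curve `c` on which `Z` is cut out by a polynomial of the parameter:
if the polynomial vanishes then no point of the curve is isolated in `Z`, otherwise its roots
are counted. When the curve passes through the origin, one root is lost to it. -/
theorem encard_isolatedPoints_curve_le {Z : Set (ℝ × ℝ)} {c : ℝ → ℝ × ℝ} {O : Set ℝ}
    (hO : IsOpen O) (hc : ContinuousOn c O) (hinj : InjOn c O) {P : ℝ[X]} {n : ℕ}
    (hdeg : P.natDegree ≤ n + 1) (hP : ∀ t ∈ O, c t ∈ Z ↔ P.eval t = 0) :
    (isolatedPoints Z ∩ {z | 0 < z.1} ∩ c '' O).encard ≤ ((n + 1 : ℕ) : ℕ∞) ∧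
      (0 ∈ c '' O → 0 ∈ Z →
        (isolatedPoints Z ∩ {z | 0 < z.1} ∩ c '' O).encard ≤ (n : ℕ∞)) := by
  by_cases hP0 : P = 0
  · have hempty : isolatedPoints Z ∩ {z | 0 < z.1} ∩ c '' O = ∅ := by
      rw [eq_empty_iff_forall_notMem]
      rintro _ ⟨⟨⟨-, hiso⟩, -⟩, t, ht, rfl⟩
      have htend : Tendsto c (𝓝[≠] t) (𝓝[≠] (c t)) := by
        refine tendsto_nhdsWithin_iff.2 ⟨((hc.continuousAt (hO.mem_nhds ht)).tendsto).mono_left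
          nhdsWithin_le_nhds, ?_⟩
        filter_upwards [self_mem_nhdsWithin, nhdsWithin_le_nhds (hO.mem_nhds ht)] with s hs hsO
        exact fun h => hs (hinj hsO ht h)
      obtain ⟨s, hs, hsO⟩ := ((htend.eventually hiso).and
        (nhdsWithin_le_nhds (hO.mem_nhds ht))).exists
      exact hs ((hP s hsO).2 (by simp [hP0]))
    simp [hempty]
  have hroot : ∀ t ∈ O, c t ∈ Z → t ∈ P.roots.toFinset := fun t ht h =>
    Multiset.mem_toFinset.2 ((mem_roots hP0).2 ((hP t ht).1 h))
  have hcard : P.roots.toFinset.card ≤ n + 1 :=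
    (Multiset.toFinset_card_le _).trans ((card_roots' P).trans hdeg)
  constructor
  · have hsub : isolatedPoints Z ∩ {z | 0 < z.1} ∩ c '' O ⊆ c '' (P.roots.toFinset : Set ℝ) := by
      rintro _ ⟨⟨⟨hz, -⟩, -⟩, t, ht, rfl⟩
      exact ⟨t, hroot t ht hz, rfl⟩
    refine (encard_le_encard hsub).trans ((encard_image_le _ _).trans ?_)
    rw [encard_coe_eq_coe_finsetCard]
    exact_mod_cast hcard
  · rintro ⟨t₀, ht₀, h0⟩ h0Z
    have hsub : isolatedPoints Z ∩ {z | 0 < z.1} ∩ c '' O ⊆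
        c '' (P.roots.toFinset.erase t₀ : Set ℝ) := by
      rintro _ ⟨⟨⟨hz, -⟩, hpos⟩, t, ht, rfl⟩
      refine ⟨t, Finset.mem_coe.2 (Finset.mem_erase.2 ⟨?_, hroot t ht hz⟩), rfl⟩
      rintro rfl
      rw [h0] at hpos
      exact lt_irrefl (0 : ℝ) hpos
    refine (encard_le_encard hsub).trans ((encard_image_le _ _).trans ?_)
    rw [encard_coe_eq_coe_finsetCard,
      Finset.card_erase_of_mem (hroot t₀ ht₀ (by rw [h0]; exact h0Z))]
    exact_mod_cast Nat.sub_le_iff_le_add.2 hcard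

/-- The numerator `X ^ 4 * f (N / X)` of `f (N / X)` for `f` of degree at most `4`. -/
noncomputable def clearDenom (f N : ℝ[X]) : ℝ[X] :=
  ∑ i ∈ Finset.range 5, C (f.coeff i) * N ^ i * X ^ (4 - i)

theorem eval_clearDenom {f N : ℝ[X]} (hf : f.natDegree ≤ 4) {u : ℝ} (hu : u ≠ 0) :
    (clearDenom f N).eval u = u ^ 4 * f.eval (N.eval u / u) := by
  rw [eval_eq_sum_range' (Nat.lt_succ_of_le hf), clearDenom, eval_finsetSum, Finset.mul_sum]
  refine Finset.sum_congr rfl fun i hi => ?_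
  have hi : i ≤ 4 := Nat.le_of_lt_succ (Finset.mem_range.1 hi)
  have : u ^ 4 = u ^ i * u ^ (4 - i) := by rw [← pow_add, Nat.add_sub_cancel' hi]
  simp only [eval_mul, eval_C, eval_pow, eval_X, div_pow, this]
  field_simp

theorem natDegree_clearDenom_le {f N : ℝ[X]} (hN : N.natDegree ≤ 2) :
    (clearDenom f N).natDegree ≤ 8 := by
  refine natDegree_sum_le_of_forall_le _ _ fun i hi => ?_
  have hi : i ≤ 4 := Nat.le_of_lt_succ (Finset.mem_range.1 hi)
  have h1 : (N ^ i).natDegree ≤ i * 2 := natDegree_pow_le_of_le i hN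
  have h2 : (C (f.coeff i) * N ^ i).natDegree ≤ i * 2 := (natDegree_C_mul_le _ _).trans h1
  have h3 : (X ^ (4 - i) : ℝ[X]).natDegree ≤ 4 - i := (natDegree_X_pow _).le
  exact (natDegree_mul_le_of_le h2 h3).trans (by omega)

/-- A line `t ↦ (t - a, m t + e)` on which `Z` is given by `f x = g y` contributes at most four isolated
points, and at most three if it passes through the origin. -/
theorem encard_isolatedPoints_line_le {f g : ℝ[X]} (hf : f.natDegree ≤ 4) (hg : g.natDegree ≤ 4)
    {Z : Set (ℝ × ℝ)} {a m e : ℝ}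
    (hZ : ∀ t : ℝ, (t - a, m * t + e) ∈ Z ↔ f.eval (t - a) = g.eval (m * t + e)) :
    (isolatedPoints Z ∩ {z | 0 < z.1} ∩ range fun t => (t - a, m * t + e)).encard ≤ 4 ∧
      (0 ∈ (range fun t : ℝ => (t - a, m * t + e)) → 0 ∈ Z →
        (isolatedPoints Z ∩ {z | 0 < z.1} ∩ range fun t => (t - a, m * t + e)).encard ≤ 3) := by
  have hlin : ∀ p q : ℝ, (C p * X + C q : ℝ[X]).natDegree ≤ 1 := fun p q => by compute_degree
  have h := encard_isolatedPoints_curve_le (Z := Z) (c := fun t : ℝ => (t - a, m * t + e))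
    (O := univ) isOpen_univ (by fun_prop) (n := 3)
    (P := f.comp (C 1 * X + C (-a)) - g.comp (C m * X + C e)) ?_ ?_ ?_
  · rw [image_univ] at h
    exact h
  · intro s _ t _ hst
    have h1 : s - a = t - a := congrArg Prod.fst hst
    linarith
  · exact natDegree_sub_le_of_le (natDegree_comp_le.trans (Nat.mul_le_mul hf (hlin 1 (-a))))
      (natDegree_comp_le.trans (Nat.mul_le_mul hg (hlin m e)))
  · intro t _
    rw [hZ]
    simp [sub_eq_zero, ← sub_eq_add_neg]

/-- A conic `x² + 2 c x = D y² - 2 B y` with `D > 0` and a quartic `f x = g y` through the origin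
have at most seven isolated common points with `x > 0`. In the asymptotic coordinates
`u = x + c + √D (y - B / D)` and `v = x + c - √D (y - B / D)` the conic is `u v = k`; it is
parametrized by `u` if `k ≠ 0`, and it is a pair of lines if `k = 0`. -/
theorem encard_isolatedPoints_conic_le {f g : ℝ[X]} (hf : f.natDegree ≤ 4) (hg : g.natDegree ≤ 4)
    (h0 : f.eval 0 = g.eval 0) {B c D : ℝ} (hD : 0 < D) {Z : Set (ℝ × ℝ)}
    (hZ : ∀ z, z ∈ Z ↔ f.eval z.1 = g.eval z.2 ∧
      z.1 ^ 2 + 2 * c * z.1 = D * z.2 ^ 2 - 2 * B * z.2) :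
    (isolatedPoints Z ∩ {z | 0 < z.1}).encard ≤ 7 := by
  obtain ⟨r, hr, rfl⟩ : ∃ r : ℝ, 0 < r ∧ r ^ 2 = D := ⟨√D, Real.sqrt_pos.2 hD, Real.sq_sqrt hD.le⟩
  have hr0 : r ≠ 0 := hr.ne'
  obtain ⟨e, rfl⟩ : ∃ e, B = r ^ 2 * e := ⟨B / r ^ 2, by field_simp⟩
  set k := c ^ 2 - r ^ 2 * e ^ 2 with hk
  have hconic : ∀ x y : ℝ, x ^ 2 + 2 * c * x = r ^ 2 * y ^ 2 - 2 * (r ^ 2 * e) * y ↔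
      (x + c + r * (y - e)) * (x + c - r * (y - e)) = k := by
    intro x y
    rw [hk]
    constructor <;> intro h <;> linarith
  have h0Z : (0 : ℝ × ℝ) ∈ Z := (hZ 0).2 ⟨h0, by simp⟩
  by_cases hk0 : k = 0
  · -- The line `v = 0` and the line `u = 0`.
    set ℓ₁ : ℝ → ℝ × ℝ := fun t => (t - c, r⁻¹ * t + e) with hℓ₁
    set ℓ₂ : ℝ → ℝ × ℝ := fun t => (t - c, -r⁻¹ * t + e) with hℓ₂
    have hline₁ := encard_isolatedPoints_line_le hf hg (Z := Z) (a := c) (m := r⁻¹) (e := e)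
      fun t => by
        rw [hZ, hconic, hk0]
        refine and_iff_left ?_
        simp only
        field_simp
        ring
    have hline₂ := encard_isolatedPoints_line_le hf hg (Z := Z) (a := c) (m := -r⁻¹) (e := e)
      fun t => by
        rw [hZ, hconic, hk0]
        refine and_iff_left ?_
        simp only
        field_simp
        ring
    have hmem : ∀ z ∈ Z, z ∈ range ℓ₁ ∨ z ∈ range ℓ₂ := by
      intro z hz
      have h := (hconic z.1 z.2).1 ((hZ z).1 hz).2
      rw [hk0, mul_eq_zero] at h
      rcases h with h | h
      · right
        refine ⟨z.1 + c, Prod.ext (by simp [hℓ₂]) ?_⟩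
        have : z.1 + c = -(r * (z.2 - e)) := by linarith
        simp only [hℓ₂, this]
        field_simp
        ring
      · left
        refine ⟨z.1 + c, Prod.ext (by simp [hℓ₁]) ?_⟩
        have : z.1 + c = r * (z.2 - e) := by linarith
        simp only [hℓ₁, this]
        field_simp
        ring
    have hsub : isolatedPoints Z ∩ {z | 0 < z.1} ⊆
        (isolatedPoints Z ∩ {z | 0 < z.1} ∩ range ℓ₁) ∪
          (isolatedPoints Z ∩ {z | 0 < z.1} ∩ range ℓ₂) := by
      intro z hz
      exact (hmem z hz.1.1).imp (fun h => ⟨hz, h⟩) fun h => ⟨hz, h⟩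
    refine (encard_le_encard hsub).trans ((encard_union_le _ _).trans ?_)
    rcases hmem 0 h0Z with h | h
    · exact (add_le_add (hline₁.2 h h0Z) hline₂.1).trans (by norm_num)
    · exact (add_le_add hline₁.1 (hline₂.2 h h0Z)).trans (by norm_num)
  · set γ : ℝ → ℝ × ℝ := fun u => ((u + k / u) / 2 - c, (u - k / u) / (2 * r) + e) with hγ
    have hγu : ∀ u, (γ u).1 + c + r * ((γ u).2 - e) = u := by
      intro u
      simp only [hγ]
      generalize k / u = w
      field_simp
      ring
    have hγv : ∀ u, (γ u).1 + c - r * ((γ u).2 - e) = k / u := by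
      intro u
      simp only [hγ]
      generalize k / u = w
      field_simp
      ring
    have hmem : ∀ z ∈ Z, z ∈ γ '' {0}ᶜ := by
      intro z hz
      have h := (hconic z.1 z.2).1 ((hZ z).1 hz).2
      set u := z.1 + c + r * (z.2 - e) with hu
      have hu0 : u ≠ 0 := by
        rintro h'
        rw [h', zero_mul] at h
        exact hk0 h.symm
      refine ⟨u, hu0, ?_⟩
      have hv : k / u = z.1 + c - r * (z.2 - e) := by rw [← h]; field_simp
      simp only [hγ, hv]
      refine Prod.ext ?_ ?_
      · simp only [hu]; ring
      · simp only [hu]; field_simp; ring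
    have hcount := encard_isolatedPoints_curve_le (Z := Z) (c := γ) (O := {0}ᶜ)
      isOpen_compl_singleton ?_ ?_ (n := 7)
      (P := clearDenom f (C (1 / 2) * X ^ 2 + C (-c) * X + C (k / 2)) -
        clearDenom g (C (1 / (2 * r)) * X ^ 2 + C e * X + C (-k / (2 * r)))) ?_ ?_
    · have hsub : isolatedPoints Z ∩ {z | 0 < z.1} ⊆
          isolatedPoints Z ∩ {z | 0 < z.1} ∩ γ '' {0}ᶜ := fun z hz => ⟨hz, hmem z hz.1.1⟩
      exact (encard_le_encard hsub).trans (hcount.2 (hmem 0 h0Z) h0Z)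
    · intro u hu
      have hu : u ≠ 0 := hu
      have h1 : ContinuousAt (fun u : ℝ => k / u) u := continuousAt_const.div continuousAt_id hu
      exact ContinuousAt.continuousWithinAt (by fun_prop)
    · intro s _ t _ hst
      rw [← hγu s, ← hγu t, hst]
    · exact natDegree_sub_le_of_le (natDegree_clearDenom_le (by compute_degree))
        (natDegree_clearDenom_le (by compute_degree))
    · intro u hu
      have hu : u ≠ 0 := hu
      have e₁ : ((C (1 / 2) * X ^ 2 + C (-c) * X + C (k / 2) : ℝ[X])).eval u / u = (γ u).1 := by
        simp [hγ]
        field_simp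
        ring
      have e₂ : ((C (1 / (2 * r)) * X ^ 2 + C e * X + C (-k / (2 * r)) : ℝ[X])).eval u / u =
          (γ u).2 := by
        simp [hγ]
        field_simp
        ring
      rw [eval_sub, eval_clearDenom hf hu, eval_clearDenom hg hu, e₁, e₂, ← mul_sub, mul_eq_zero,
        or_iff_right (pow_ne_zero 4 hu), sub_eq_zero, hZ, hconic, hγu, hγv]
      exact and_iff_left (by field_simp)

end

/-! ### Quartic Hamiltonians and the bound -/

/-- The coefficients of a real polynomial of degree at most four in two variables without constant
term; `kij` is the coefficient of `x ^ i * y ^ j`. -/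
structure QuarticCoeffs where
  /-- The coefficient of `x`. -/
  k10 : ℝ := 0
  /-- The coefficient of `y`. -/
  k01 : ℝ := 0
  /-- The coefficient of `x ^ 2`. -/
  k20 : ℝ := 0
  /-- The coefficient of `x * y`. -/
  k11 : ℝ := 0
  /-- The coefficient of `y ^ 2`. -/
  k02 : ℝ := 0
  /-- The coefficient of `x ^ 3`. -/
  k30 : ℝ := 0
  /-- The coefficient of `x ^ 2 * y`. -/
  k21 : ℝ := 0
  /-- The coefficient of `x * y ^ 2`. -/
  k12 : ℝ := 0
  /-- The coefficient of `y ^ 3`. -/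
  k03 : ℝ := 0
  /-- The coefficient of `x ^ 4`. -/
  k40 : ℝ := 0
  /-- The coefficient of `x ^ 3 * y`. -/
  k31 : ℝ := 0
  /-- The coefficient of `x ^ 2 * y ^ 2`. -/
  k22 : ℝ := 0
  /-- The coefficient of `x * y ^ 3`. -/
  k13 : ℝ := 0
  /-- The coefficient of `y ^ 4`. -/
  k04 : ℝ := 0

namespace QuarticCoeffs

/-- The polynomial with the coefficients `k`. -/
def ham (k : QuarticCoeffs) (p : ℝ × ℝ) : ℝ :=
  k.k10 * p.1 + k.k01 * p.2 + k.k20 * p.1 ^ 2 + k.k11 * p.1 * p.2 + k.k02 * p.2 ^ 2 +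
    k.k30 * p.1 ^ 3 + k.k21 * p.1 ^ 2 * p.2 + k.k12 * p.1 * p.2 ^ 2 + k.k03 * p.2 ^ 3 +
    k.k40 * p.1 ^ 4 + k.k31 * p.1 ^ 3 * p.2 + k.k22 * p.1 ^ 2 * p.2 ^ 2 +
    k.k13 * p.1 * p.2 ^ 3 + k.k04 * p.2 ^ 4

/-- The partial derivative of `k.ham` with respect to `x`. -/
def dx (k : QuarticCoeffs) (p : ℝ × ℝ) : ℝ :=
  k.k10 + 2 * k.k20 * p.1 + k.k11 * p.2 + 3 * k.k30 * p.1 ^ 2 + 2 * k.k21 * p.1 * p.2 +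
    k.k12 * p.2 ^ 2 + 4 * k.k40 * p.1 ^ 3 + 3 * k.k31 * p.1 ^ 2 * p.2 +
    2 * k.k22 * p.1 * p.2 ^ 2 + k.k13 * p.2 ^ 3

/-- The partial derivative of `k.ham` with respect to `y`. -/
def dy (k : QuarticCoeffs) (p : ℝ × ℝ) : ℝ :=
  k.k01 + k.k11 * p.1 + 2 * k.k02 * p.2 + k.k21 * p.1 ^ 2 + 2 * k.k12 * p.1 * p.2 +
    3 * k.k03 * p.2 ^ 2 + k.k31 * p.1 ^ 3 + 2 * k.k22 * p.1 ^ 2 * p.2 +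
    3 * k.k13 * p.1 * p.2 ^ 2 + 4 * k.k04 * p.2 ^ 3

/-- The Hamiltonian field of `k.ham`. -/
def field (k : QuarticCoeffs) : PlaneField := fun p => (k.dy p, -k.dx p)

theorem isHamiltonian (k : QuarticCoeffs) : IsHamiltonian k.field k.ham := by
  intro p
  have mon : ∀ (c : ℝ) (i j : ℕ), HasFDerivAt (fun p : ℝ × ℝ => c * (p.1 ^ i * p.2 ^ j)) _ p :=
    fun c i j => (((hasFDerivAt_fst (𝕜 := ℝ) (p := p)).pow i).mul
      ((hasFDerivAt_snd (𝕜 := ℝ) (p := p)).pow j)).const_mul c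
  have := ((((((((((((((mon k.k10 1 0).add (mon k.k01 0 1)).add (mon k.k20 2 0)).add
    (mon k.k11 1 1)).add (mon k.k02 0 2)).add (mon k.k30 3 0)).add (mon k.k21 2 1)).add
    (mon k.k12 1 2)).add (mon k.k03 0 3)).add (mon k.k40 4 0)).add (mon k.k31 3 1)).add
    (mon k.k22 2 2)).add (mon k.k13 1 3)).add (mon k.k04 0 4))
  refine (this.congr_fderiv ?_).congr_of_eventuallyEq (Eventually.of_forall fun q => ?_)
  · ext
    · simp [field, dx]
      ring
    · simp [field, dy]
      ring
  · simp [ham]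
    ring

theorem contDiff (k : QuarticCoeffs) : ContDiff ℝ 1 k.field := by
  unfold field dx dy
  fun_prop

theorem locallyLipschitz (k : QuarticCoeffs) : LocallyLipschitz k.field :=
  k.contDiff.locallyLipschitz

open Polynomial in
/-- The restriction of `k.ham` to a line is a polynomial of degree at most four. -/
theorem exists_polynomial (k : QuarticCoeffs) (a c α γ δ : ℝ) :
    ∃ f : ℝ[X], f.natDegree ≤ 4 ∧ ∀ t, f.eval t = k.ham (a * t + c, α * t + γ) / δ := by
  refine ⟨C (1 / δ) * (C k.k10 * (C a * X + C c) + C k.k01 * (C α * X + C γ) +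
    C k.k20 * (C a * X + C c) ^ 2 + C k.k11 * (C a * X + C c) * (C α * X + C γ) +
    C k.k02 * (C α * X + C γ) ^ 2 + C k.k30 * (C a * X + C c) ^ 3 +
    C k.k21 * (C a * X + C c) ^ 2 * (C α * X + C γ) +
    C k.k12 * (C a * X + C c) * (C α * X + C γ) ^ 2 + C k.k03 * (C α * X + C γ) ^ 3 +
    C k.k40 * (C a * X + C c) ^ 4 + C k.k31 * (C a * X + C c) ^ 3 * (C α * X + C γ) +
    C k.k22 * (C a * X + C c) ^ 2 * (C α * X + C γ) ^ 2 +
    C k.k13 * (C a * X + C c) * (C α * X + C γ) ^ 3 + C k.k04 * (C α * X + C γ) ^ 4), ?_, ?_⟩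
  · compute_degree
  · intro t
    simp only [eval_add, eval_mul, eval_pow, eval_C, eval_X, ham]
    ring

end QuarticCoeffs

theorem linearCenter_eq_field (κ A B C ω : ℝ) :
    κ • linearCenter A B C ω = QuarticCoeffs.field
      { k10 := -κ * C, k01 := κ * B, k20 := -κ / 2, k11 := -κ * A,
        k02 := -κ * (A ^ 2 + ω ^ 2) / 2 } := by
  ext p
  · simp [linearCenter, QuarticCoeffs.field, QuarticCoeffs.dy]
    ring
  · simp [linearCenter, QuarticCoeffs.field, QuarticCoeffs.dx]
    ring

theorem IsNormalForm.exists_eq_field {s : SaddleClass} {F : PlaneField} (h : IsNormalForm s F) :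
    ∃ k : QuarticCoeffs, F = k.field := by
  have h3 : ∀ a b c : ℝ, ∃ k : QuarticCoeffs, field3 a b c = k.field := fun a b c =>
    ⟨{ k20 := -(c - a ^ 2 / (b + c)) / 2, k11 := a, k02 := b / 2, k22 := -3 / 2, k04 := 1 / 4 }, by
      ext p <;> simp [field3, QuarticCoeffs.field, QuarticCoeffs.dx, QuarticCoeffs.dy] <;> ring⟩
  have h4 : ∀ a b c : ℝ, ∃ k : QuarticCoeffs, field4 a b c = k.field := fun a b c =>
    ⟨{ k20 := -(c - a ^ 2 / (b + c)) / 2, k11 := a, k02 := b / 2, k22 := -3 / 2, k04 := -1 / 4 }, by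
      ext p <;> simp [field4, QuarticCoeffs.field, QuarticCoeffs.dx, QuarticCoeffs.dy] <;> ring⟩
  have h5 : ∀ a b c μ : ℝ, ∃ k : QuarticCoeffs, field5 a b c μ = k.field := fun a b c μ =>
    ⟨{ k20 := -(c - a ^ 2 / (b + c)) / 2, k11 := a, k02 := b / 2, k40 := -1 / 4,
       k22 := -3 * μ / 2, k04 := 1 / 4 }, by
      ext p <;> simp [field5, QuarticCoeffs.field, QuarticCoeffs.dx, QuarticCoeffs.dy] <;> ring⟩
  have h6 : ∀ a b c μ : ℝ, ∃ k : QuarticCoeffs, field6 a b c μ = k.field := fun a b c μ =>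
    ⟨{ k20 := -(c - a ^ 2 / (b + c)) / 2, k11 := a, k02 := b / 2, k40 := -1 / 4,
       k22 := -3 * μ / 2, k04 := -1 / 4 }, by
      ext p <;> simp [field6, QuarticCoeffs.field, QuarticCoeffs.dx, QuarticCoeffs.dy] <;> ring⟩
  cases s
  · obtain ⟨a, b, -, rfl⟩ := h
    exact ⟨{ k20 := a ^ 2 / b / 2, k11 := a, k02 := b / 2, k40 := -1 / 4 }, by
      ext p <;> simp only [field1, QuarticCoeffs.field, QuarticCoeffs.dx, QuarticCoeffs.dy] <;>
        ring⟩
  · obtain ⟨a, b, -, -, rfl⟩ := h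
    exact ⟨{ k20 := a ^ 2 / b / 2, k11 := a, k02 := b / 2, k31 := -1 }, by
      ext p <;> simp only [field2, QuarticCoeffs.field, QuarticCoeffs.dx, QuarticCoeffs.dy] <;>
        ring⟩
  · obtain ⟨c, -, rfl⟩ := h
    exact h3 _ _ _
  · obtain ⟨a, b, -, -, rfl⟩ := h
    exact h3 _ _ _
  · obtain ⟨c, -, rfl⟩ := h
    exact h4 _ _ _
  · obtain ⟨a, b, -, -, rfl⟩ := h
    exact h4 _ _ _
  · obtain ⟨c, μ, -, rfl⟩ := h
    exact h5 _ _ _ _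
  · obtain ⟨a, b, μ, -, -, rfl⟩ := h
    exact h5 _ _ _ _
  · obtain ⟨c, μ, -, rfl⟩ := h
    exact h6 _ _ _ _
  · obtain ⟨a, b, μ, -, -, rfl⟩ := h
    exact h6 _ _ _ _

/-- An affine change of variables divides the Hamiltonian by the determinant. -/
theorem IsHamiltonian.affineChange {F : PlaneField} {H : ℝ × ℝ → ℝ} (h : IsHamiltonian F H)
    {a₁ b₁ c₁ α₁ β₁ γ₁ : ℝ} (hdet : a₁ * β₁ - b₁ * α₁ ≠ 0) :
    IsHamiltonian (affineChange a₁ b₁ c₁ α₁ β₁ γ₁ F) fun p =>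
      H (a₁ * p.1 + b₁ * p.2 + c₁, α₁ * p.1 + β₁ * p.2 + γ₁) / (a₁ * β₁ - b₁ * α₁) := by
  intro p
  have hx := hasFDerivAt_fst (𝕜 := ℝ) (E := ℝ) (F := ℝ) (p := p)
  have hy := hasFDerivAt_snd (𝕜 := ℝ) (E := ℝ) (F := ℝ) (p := p)
  have hφ : HasFDerivAt (fun p : ℝ × ℝ =>
      ((a₁ * p.1 + b₁ * p.2 + c₁, α₁ * p.1 + β₁ * p.2 + γ₁) : ℝ × ℝ)) _ p :=
    (((hx.const_mul a₁).add (hy.const_mul b₁)).add_const c₁).prodMk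
      (((hx.const_mul α₁).add (hy.const_mul β₁)).add_const γ₁)
  simp only [div_eq_mul_inv]
  refine (((h _).comp p hφ).mul_const _).congr_fderiv ?_
  ext
  · simp [NilpotentPiecewise.affineChange]
    field_simp
    ring
  · simp [NilpotentPiecewise.affineChange]
    field_simp

theorem contDiff_affineChange {F : PlaneField} (hF : ContDiff ℝ 1 F) (a₁ b₁ c₁ α₁ β₁ γ₁ : ℝ) :
    ContDiff ℝ 1 (affineChange a₁ b₁ c₁ α₁ β₁ γ₁ F) := by
  have hv : ContDiff ℝ 1 fun p : ℝ × ℝ =>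
      F (a₁ * p.1 + b₁ * p.2 + c₁, α₁ * p.1 + β₁ * p.2 + γ₁) := hF.comp (by fun_prop)
  unfold affineChange
  exact (((contDiff_const.mul hv.fst).sub (contDiff_const.mul hv.snd)).div_const _).prodMk
    (((contDiff_const.mul hv.snd).sub (contDiff_const.mul hv.fst)).div_const _)

/-- The upper bound for the number of crossing limit cycles. -/
theorem encard_limitCycles_le_seven {s : SaddleClass} {κ A B C ω : ℝ} {Y : PlaneField}
    (hκ : κ ≠ 0) (hω : 0 < ω) (hY : InClass s Y) :
    {Γ | IsCrossingLimitCycle (κ • linearCenter A B C ω) Y Γ}.encard ≤ 7 := by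
  obtain ⟨F, a₁, b₁, c₁, α₁, β₁, γ₁, hF, hdet, rfl⟩ := hY
  obtain ⟨k, rfl⟩ := hF.exists_eq_field
  have hdet' : a₁ * β₁ - b₁ * α₁ ≠ 0 := fun h => hdet (by linarith)
  rw [linearCenter_eq_field]
  refine (encard_limitCycles_le (QuarticCoeffs.locallyLipschitz _)
    (contDiff_affineChange k.contDiff a₁ b₁ c₁ α₁ β₁ γ₁).locallyLipschitz
    (QuarticCoeffs.isHamiltonian _) (k.isHamiltonian.affineChange hdet')).trans ?_
  obtain ⟨f, hf, hfe⟩ := k.exists_polynomial a₁ c₁ α₁ γ₁ (a₁ * β₁ - b₁ * α₁)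
  obtain ⟨g, hg, hge⟩ := k.exists_polynomial b₁ c₁ β₁ γ₁ (a₁ * β₁ - b₁ * α₁)
  refine encard_isolatedPoints_conic_le hf hg (by simp [hfe, hge]) (B := B) (c := C)
    (by positivity : 0 < A ^ 2 + ω ^ 2) fun z => ?_
  simp only [matchSet, mem_ofPred_eq, hfe, hge, mul_zero, add_zero, zero_add]
  refine and_congr_right fun _ => ?_
  have : ∀ u v w : ℝ, u - v = -κ / 2 * w → (u = v ↔ w = 0) := by
    intro u v w h
    rw [← sub_eq_zero, h, mul_eq_zero, or_iff_right (by simpa using hκ)]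
  rw [← sub_eq_zero (a := z.1 ^ 2 + 2 * C * z.1)]
  refine this _ _ _ ?_
  simp [QuarticCoeffs.ham]
  ring

/-! ### Arcs in the quadrant and around it -/

/-- Arcs of a Hamiltonian field which points to the upper left on a rectangle `[0, a] × [0, b]`
with `H (a, 0) = H (0, b)`. The solution from `(a, 0)` of the field truncated outside of the
rectangle reaches the `y`-axis; it does not cross the upper side before, where `H` is below
`H (0, b)`. -/
theorem exists_isArc_of_monotone {F : PlaneField} {H : ℝ × ℝ → ℝ} (hF : LocallyLipschitz F)
    (hH : IsHamiltonian F H) {a b : ℝ} (ha : 0 < a) (hb : 0 < b) (hab : H (a, 0) = H (0, b))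
    (hbox : ∀ x ∈ Icc 0 a, ∀ y ∈ Icc 0 b, (F (x, y)).1 < 0 ∧ 0 < (F (x, y)).2) :
    ∃ S, IsArc F (SigmaPlus \ Sigma) (a, 0) (0, b) S := by
  obtain ⟨K, L, hK, hL⟩ := exists_lipschitz_bound_clamp hF ha.le hb.le
  set G : PlaneField := F ∘ clamp 0 a 0 b with hG
  have hGbox : ∀ p, (G p).1 < 0 ∧ 0 < (G p).2 := fun p =>
    hbox _ (clamp_mem ha.le hb.le p).1 _ (clamp_mem ha.le hb.le p).2
  obtain ⟨m, hm, hGm⟩ : ∃ m > 0, ∀ p, (G p).1 ≤ -m := by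
    obtain ⟨p, hp, hmax⟩ := (isCompact_Icc.prod isCompact_Icc).exists_isMaxOn
      (s := Icc 0 a ×ˢ Icc 0 b) ⟨(0, 0), ⟨le_rfl, ha.le⟩, le_rfl, hb.le⟩
      (continuous_fst.comp hF.continuous).continuousOn
    exact ⟨-(F p).1, neg_pos.2 (hbox _ hp.1 _ hp.2).1, fun z =>
      (neg_neg (F p).1).symm ▸ hmax (clamp_mem ha.le hb.le z)⟩
  have hT₀ : 0 < a / m := div_pos ha hm
  obtain ⟨z, hz0, hz⟩ := exists_isSolutionOn hK hL hT₀.le (a, 0)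
  have hz1 := hz.strictAntiOn_clm (ContinuousLinearMap.fst ℝ ℝ ℝ) le_rfl le_rfl
    fun t _ => (hGbox (z t)).1
  have hz2 := hz.strictMonoOn_clm (ContinuousLinearMap.snd ℝ ℝ ℝ) le_rfl le_rfl
    fun t _ => (hGbox (z t)).2
  simp only [ContinuousLinearMap.coe_fst', ContinuousLinearMap.coe_snd'] at hz1 hz2
  have hc1 : ContinuousOn (fun t => (z t).1) (Icc 0 (a / m)) := hz.continuousOn.fst
  have hc2 : ContinuousOn (fun t => (z t).2) (Icc 0 (a / m)) := hz.continuousOn.snd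
  have hzend : (z (a / m)).1 ≤ 0 := by
    have hd : ∀ t ∈ interior (Icc 0 (a / m)), HasDerivAt (fun t => (z t).1) (G (z t)).1 t := by
      intro t ht
      rw [interior_Icc] at ht
      exact hz.hasDerivAt_clm (ContinuousLinearMap.fst ℝ ℝ ℝ) ht
    have := (convex_Icc 0 (a / m)).image_sub_le_mul_sub_of_deriv_le hc1
      (fun t ht => (hd t ht).differentiableAt.differentiableWithinAt) (C := -m)
      (fun t ht => (hd t ht).deriv ▸ hGm _) 0 (left_mem_Icc.2 hT₀.le) (a / m)
      (right_mem_Icc.2 hT₀.le) hT₀.le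
    rw [hz0] at this
    field_simp at this
    linarith
  obtain ⟨T, hT, hT0⟩ : (0 : ℝ) ∈ (fun t => (z t).1) '' Icc 0 (a / m) :=
    intermediate_value_Icc' hT₀.le hc1 ⟨hzend, by rw [hz0]; exact ha.le⟩
  simp only at hT0
  have hTpos : 0 < T := by
    rcases eq_or_lt_of_le hT.1 with h | h
    · rw [← h, hz0] at hT0
      exact absurd hT0 ha.ne'
    · exact h
  have hsub : Icc 0 T ⊆ Icc 0 (a / m) := Icc_subset_Icc_right hT.2
  have hx : ∀ t ∈ Icc 0 T, (z t).1 ∈ Icc 0 a := by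
    intro t ht
    constructor
    · rw [← hT0]
      exact hz1.antitoneOn (hsub ht) hT ht.2
    · have := hz1.antitoneOn (left_mem_Icc.2 hT₀.le) (hsub ht) ht.1
      simpa [hz0] using this
  have hy : ∀ t ∈ Icc 0 T, 0 ≤ (z t).2 := by
    intro t ht
    have := hz2.monotoneOn (left_mem_Icc.2 hT₀.le) (hsub ht) ht.1
    simpa [hz0] using this
  -- As long as the solution is in the rectangle it solves the original equation.
  have hin : ∀ t ∈ Icc 0 T, (z t).2 ≤ b → IsSolutionOn F t z := by
    intro t ht htb
    refine (hz.mono (ht.2.trans hT.2)).congr_field fun s hs => ?_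
    have hs' : s ∈ Icc 0 T := ⟨hs.1, hs.2.trans ht.2⟩
    have : (z s).2 ≤ b := (hz2.monotoneOn (hsub hs') (hsub ht) hs.2).trans htb
    rw [hG, Function.comp_apply, clamp_eq_self (hx s hs') ⟨hy s hs', this⟩]
  have hconst : ∀ t ∈ Icc 0 T, (z t).2 ≤ b → H (z t) = H (0, b) := by
    intro t ht htb
    rw [hH.const_of_isSolutionOn (hin t ht htb) (right_mem_Icc.2 ht.1), hz0, hab]
  have hyb : ∀ t ∈ Icc 0 T, (z t).2 ≤ b := by
    by_contra! hcon
    obtain ⟨t, ht, htb⟩ := hcon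
    obtain ⟨s, hs, hsb⟩ : b ∈ (fun t => (z t).2) '' Icc 0 t :=
      intermediate_value_Icc ht.1 (hc2.mono ((Icc_subset_Icc_right ht.2).trans hsub))
        ⟨by rw [hz0]; exact hb.le, htb.le⟩
    simp only at hsb
    have hst : s < T := by
      refine lt_of_lt_of_le (lt_of_le_of_ne hs.2 ?_) ht.2
      rintro rfl
      exact htb.ne' hsb
    have hs' : s ∈ Icc 0 T := ⟨hs.1, hst.le⟩
    have hxs : 0 < (z s).1 := by
      rw [← hT0]
      exact hz1 (hsub hs') hT hst
    have hanti : StrictAntiOn (fun x => H (x, b)) (Icc 0 a) :=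
      strictAntiOn_of_hasDerivWithinAt_neg (convex_Icc 0 a)
        (fun x _ => (hH.hasDerivAt_fst x b).continuousAt.continuousWithinAt)
        (fun x _ => (hH.hasDerivAt_fst x b).hasDerivWithinAt)
        (fun x hx => neg_neg_iff_pos.2 (hbox x (interior_subset hx) b ⟨hb.le, le_rfl⟩).2)
    have h1 := hanti ⟨le_rfl, ha.le⟩ (hx s hs') hxs
    have h2 := hconst s hs' hsb.le
    rw [← Prod.mk.eta (p := z s), hsb] at h2
    exact h1.ne h2
  have hTT : T ∈ Icc 0 T := right_mem_Icc.2 hTpos.le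
  have hend : (z T).2 = b := by
    have hanti : StrictAntiOn (fun y => H (0, y)) (Icc 0 b) :=
      strictAntiOn_of_hasDerivWithinAt_neg (convex_Icc 0 b)
        (fun y _ => (hH.hasDerivAt_snd 0 y).continuousAt.continuousWithinAt)
        (fun y _ => (hH.hasDerivAt_snd 0 y).hasDerivWithinAt)
        (fun y hy => (hbox 0 ⟨le_rfl, ha.le⟩ y (interior_subset hy)).1)
    refine hanti.injOn ⟨hy T hTT, hyb T hTT⟩ ⟨hb.le, le_rfl⟩ ?_
    have := hconst T hTT (hyb T hTT)
    rwa [← Prod.mk.eta (p := z T), hT0] at this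
  refine ⟨_, T, z, hTpos, hin T hTT (hyb T hTT), hz0, Prod.ext hT0 hend, fun t ht => ?_, rfl⟩
  rw [mem_plus_diff_iff]
  have ht' := Ioo_subset_Icc_self ht
  constructor
  · rw [← hT0]
    exact hz1 (hsub ht') hT ht.2
  · have := hz2 (left_mem_Icc.2 hT₀.le) (hsub ht') ht.1
    simpa [hz0] using this

/-- The circular arcs of the center `ẋ = -y`, `ẏ = x + 1 / 2` outside of the quadrant. -/
theorem exists_isArc_circle {x y : ℝ} (hx : 0 < x) (hy : 0 < y) (hxy : x ^ 2 + x = y ^ 2) :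
    ∃ S, IsArc (linearCenter 0 0 (1 / 2) 1) (SigmaMinus \ Sigma) (0, y) (x, 0) S := by
  set R := x + 1 / 2 with hR
  have hR0 : 0 < R := by positivity
  set θ := Real.arccos (1 / (2 * R)) with hθ
  have hcos : R * Real.cos θ = 1 / 2 := by
    rw [hθ, Real.cos_arccos]
    · field_simp
    · have : 0 < 1 / (2 * R) := by positivity
      linarith
    · rw [div_le_one (by positivity)]
      linarith
  have hθ0 : 0 ≤ θ := Real.arccos_nonneg _
  have hθπ : θ ≤ Real.pi := Real.arccos_le_pi _
  have hsin : R * Real.sin θ = y := by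
    have h1 : 0 ≤ R * Real.sin θ := mul_nonneg hR0.le (Real.sin_nonneg_of_nonneg_of_le_pi hθ0 hθπ)
    rw [← sq_eq_sq₀ h1 hy.le, mul_pow, Real.sin_sq, mul_sub, ← mul_pow, hcos, ← hxy, hR]
    ring
  have hd : ∀ t : ℝ, HasDerivAt (fun t => ((R * Real.cos (t + θ) - 1 / 2, R * Real.sin (t + θ)) :
      ℝ × ℝ)) (linearCenter 0 0 (1 / 2) 1 (R * Real.cos (t + θ) - 1 / 2, R * Real.sin (t + θ)))
      t := by
    intro t
    have h1 : HasDerivAt (fun t : ℝ => t + θ) 1 t := (hasDerivAt_id t).add_const θ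
    convert! ((h1.cos.const_mul R).sub_const (1 / 2)).prodMk (h1.sin.const_mul R) using 1
    simp [linearCenter]
  refine ⟨_, 2 * Real.pi - θ, _, by linarith [Real.pi_pos], fun t _ => (hd t).hasDerivWithinAt,
    ?_, ?_, ?_, rfl⟩
  · simp only [zero_add, hcos, hsin, sub_self]
  · simp [hR]
  · intro t ht
    rw [mem_minus_diff_iff]
    rcases le_or_gt (t + θ) Real.pi with h | h
    · left
      have := Real.strictAntiOn_cos ⟨hθ0, hθπ⟩ ⟨by linarith [ht.1], h⟩
        (by linarith [ht.1] : θ < t + θ)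
      have := mul_lt_mul_of_pos_left this hR0
      simp only
      linarith
    · right
      have : 0 < Real.sin (t + θ - Real.pi) :=
        Real.sin_pos_of_pos_of_lt_pi (by linarith) (by linarith [ht.2])
      rw [Real.sin_sub_pi] at this
      exact mul_neg_of_pos_of_neg hR0 (by linarith)

/-! ### Counting the crossing periodic orbits exactly -/

/-- If the crossing periodic orbits correspond to finitely many pairs `(x, y)`, then all of them
are limit cycles: each one avoids the other points on the half-axes which lie on such orbits. -/
theorem encard_limitCycles_eq {X Y : PlaneField} (hX : LocallyLipschitz X)
    (hY : LocallyLipschitz Y) {A : Finset (ℝ × ℝ)}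
    (hA : ∀ z : ℝ × ℝ, z ∈ A ↔ ∃ Γ, IsCrossingPeriodicOrbitAt X Y z.1 z.2 Γ) :
    {Γ | IsCrossingLimitCycle X Y Γ}.encard = A.card := by
  have hex : ∀ z : A, ∃ Γ, IsCrossingPeriodicOrbitAt X Y z.1.1 z.1.2 Γ :=
    fun z => (hA z.1).1 z.2
  choose φ hφ using hex
  have hinj : Function.Injective φ := by
    intro z w h
    have hw := hφ w
    rw [← h] at hw
    exact Subtype.ext (Prod.ext ((hφ w).eq_of_mem_fst (hφ z).fst_pos (h ▸ (hφ z).mem_fst))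
      ((hφ w).eq_of_mem_snd (hφ z).snd_pos (h ▸ (hφ z).mem_snd)))
  have hrange : {Γ | IsCrossingLimitCycle X Y Γ} = range φ := by
    ext Γ
    constructor
    · rintro ⟨hΓ, -⟩
      obtain ⟨x, y, h⟩ := isCrossingPeriodicOrbit_iff.1 hΓ
      exact ⟨⟨(x, y), (hA (x, y)).2 ⟨Γ, h⟩⟩, (hφ _).unique hX hY h⟩
    · rintro ⟨z, rfl⟩
      set B : Set (ℝ × ℝ) := (fun w : ℝ × ℝ => (w.1, 0)) '' {w | w ∈ A ∧ w.1 ≠ z.1.1} ∪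
        (fun w : ℝ × ℝ => (0, w.2)) '' {w | w ∈ A ∧ w.2 ≠ z.1.2} with hB
      have hfin : B.Finite := ((A.finite_toSet.subset fun w hw => hw.1).image _).union
        ((A.finite_toSet.subset fun w hw => hw.1).image _)
      refine ⟨isCrossingPeriodicOrbit_iff.2 ⟨_, _, hφ z⟩, Bᶜ, hfin.isClosed.isOpen_compl, ?_, ?_⟩
      · rintro p hp (⟨w, ⟨hwA, hne⟩, rfl⟩ | ⟨w, ⟨hwA, hne⟩, rfl⟩)
        · obtain ⟨Γ', hΓ'⟩ := (hA w).1 hwA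
          exact hne ((hφ z).eq_of_mem_fst hΓ'.fst_pos hp)
        · obtain ⟨Γ', hΓ'⟩ := (hA w).1 hwA
          exact hne ((hφ z).eq_of_mem_snd hΓ'.snd_pos hp)
      · intro Γ' hΓ' hsub
        obtain ⟨x, y, h⟩ := isCrossingPeriodicOrbit_iff.1 hΓ'
        have hmem : (x, y) ∈ A := (hA (x, y)).2 ⟨Γ', h⟩
        have hx : x = z.1.1 := by
          by_contra hne
          exact hsub h.mem_fst (Or.inl ⟨(x, y), ⟨hmem, hne⟩, rfl⟩)
        have hy : y = z.1.2 := by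
          by_contra hne
          exact hsub h.mem_snd (Or.inr ⟨(x, y), ⟨hmem, hne⟩, rfl⟩)
        subst hx hy
        exact h.unique hX hY (hφ z)
  rw [hrange, ← image_univ, hinj.encard_image, encard_univ, ENat.card_eq_coe_fintype_card,
    Fintype.card_coe]

open Polynomial in
/-- Descartes' rule of signs for polynomials of degree seven, with the signs of the coefficients
listed by `σ`. -/
theorem card_pos_roots_le {a : Fin 8 → ℝ} {σ : Fin 8 → SignType}
    (hσ : ∀ i, SignType.sign (a i) = σ i) (h7 : σ 7 ≠ 0) {S : Finset ℝ}
    (hS : ∀ s ∈ S, 0 < s ∧ ∑ i, a i * s ^ (i : ℕ) = 0) :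
    S.card ≤ ((((List.ofFn σ).reverse.filter (· ≠ 0)).destutter (· ≠ ·)).length - 1) := by
  set P : ℝ[X] := ∑ i, C (a i) * X ^ (i : ℕ) with hP
  have hcoeff : ∀ i : Fin 8, P.coeff i = a i := by
    intro i
    simp only [hP, finsetSum_coeff, coeff_C_mul, coeff_X_pow, Fin.val_inj]
    simp
  have ha7 : a 7 ≠ 0 := by
    rw [← sign_ne_zero, hσ]
    exact h7
  have hdeg : P.degree = (7 : ℕ) := by
    refine degree_eq_of_le_of_coeff_ne_zero ?_ ?_
    · refine (degree_sum_le _ _).trans (Finset.sup_le fun i _ => ?_)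
      refine (degree_C_mul_X_pow_le _ _).trans ?_
      exact_mod_cast Nat.le_of_lt_succ i.2
    · rw [show (7 : ℕ) = ((7 : Fin 8) : ℕ) from rfl, hcoeff]
      exact ha7
  have hP0 : P ≠ 0 := by
    intro h
    simp [h] at hdeg
  have hlist : P.coeffList.map SignType.sign = (List.ofFn σ).reverse := by
    have : P.coeffList = (List.ofFn a).reverse := by
      rw [coeffList, hdeg]
      rw [show a = fun i : Fin 8 => P.coeff i from funext fun i => (hcoeff i).symm]
      rfl
    rw [this, List.map_reverse, List.map_ofFn]
    congr 2
    exact funext hσ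
  have hsub : S.val ≤ P.roots.filter (0 < ·) := by
    rw [Multiset.le_iff_subset S.nodup]
    intro s hs
    obtain ⟨h1, h2⟩ := hS s hs
    rw [Multiset.mem_filter, mem_roots hP0, IsRoot.def]
    refine ⟨?_, h1⟩
    simpa [hP, eval_finsetSum] using h2
  have h := (Multiset.card_le_card hsub).trans_eq
    (Multiset.countP_eq_card_filter _ _).symm |>.trans P.roots_countP_pos_le_signVariations
  simpa [signVariations, hlist] using h

/-! ### A criterion for exactly four limit cycles -/

namespace QuarticCoeffs

/-- The coefficients of the polynomial in `s` obtained by clearing denominators in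
`k.ham (x, 0) - k.ham (0, y)` on the branch `x = 1 / ((1 + s)² - 1)`, `y = (1 + s) x`, `s > 0`, of
the conic `x² + x = y²` in the open quadrant. -/
def crossCoeff (k : QuarticCoeffs) : Fin 8 → ℝ :=
  ![k.k40 - k.k04,
    2 * k.k30 - 2 * k.k03 - 4 * k.k04,
    4 * k.k20 - 4 * k.k02 + k.k30 - 7 * k.k03 - 6 * k.k04,
    8 * k.k10 - 8 * k.k01 + 4 * k.k20 - 12 * k.k02 - 9 * k.k03 - 4 * k.k04,
    12 * k.k10 - 20 * k.k01 + k.k20 - 13 * k.k02 - 5 * k.k03 - k.k04,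
    6 * k.k10 - 18 * k.k01 - 6 * k.k02 - k.k03,
    k.k10 - 7 * k.k01 - k.k02,
    -k.k01]

/-- The polynomial function with the coefficients `k.crossCoeff`. -/
def crossEval (k : QuarticCoeffs) (s : ℝ) : ℝ := ∑ i, k.crossCoeff i * s ^ (i : ℕ)

theorem crossEval_expand (k : QuarticCoeffs) (s : ℝ) :
    k.crossEval s = (k.k40 - k.k04) + (2 * k.k30 - 2 * k.k03 - 4 * k.k04) * s +
      (4 * k.k20 - 4 * k.k02 + k.k30 - 7 * k.k03 - 6 * k.k04) * s ^ 2 +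
      (8 * k.k10 - 8 * k.k01 + 4 * k.k20 - 12 * k.k02 - 9 * k.k03 - 4 * k.k04) * s ^ 3 +
      (12 * k.k10 - 20 * k.k01 + k.k20 - 13 * k.k02 - 5 * k.k03 - k.k04) * s ^ 4 +
      (6 * k.k10 - 18 * k.k01 - 6 * k.k02 - k.k03) * s ^ 5 +
      (k.k10 - 7 * k.k01 - k.k02) * s ^ 6 + -k.k01 * s ^ 7 := by
  have h : k.crossEval s = k.crossCoeff 0 * s ^ 0 + k.crossCoeff 1 * s ^ 1 +
      k.crossCoeff 2 * s ^ 2 + k.crossCoeff 3 * s ^ 3 + k.crossCoeff 4 * s ^ 4 +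
      k.crossCoeff 5 * s ^ 5 + k.crossCoeff 6 * s ^ 6 + k.crossCoeff 7 * s ^ 7 :=
    Fin.sum_univ_eight _
  rw [h, pow_zero, pow_one, mul_one]
  rfl

theorem crossEval_eq (k : QuarticCoeffs) {s : ℝ} (hs : 0 < s) :
    k.crossEval s = ((1 + s) ^ 2 - 1) ^ 4 *
      (k.ham (1 / ((1 + s) ^ 2 - 1), 0) - k.ham (0, (1 + s) / ((1 + s) ^ 2 - 1))) := by
  have hw : (1 + s) ^ 2 - 1 ≠ 0 := by
    have : (1 + s) ^ 2 - 1 = s * (s + 2) := by ring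
    rw [this]
    positivity
  simp only [ham, crossEval_expand]
  field_simp
  ring

/-- An upper bound for the polynomial `k.dx` on `[0, M] × [0, N]`: its constant coefficient plus
the values of its terms with positive coefficients at `(M, N)`. -/
noncomputable def dxBound (k : QuarticCoeffs) (M N : ℝ) : ℝ :=
  k.k10 + 2 * (max k.k20 0 * M) + max k.k11 0 * N + 3 * (max k.k30 0 * M ^ 2) +
    2 * (max k.k21 0 * (M * N)) + max k.k12 0 * N ^ 2 + 4 * (max k.k40 0 * M ^ 3) +
    3 * (max k.k31 0 * (M ^ 2 * N)) + 2 * (max k.k22 0 * (M * N ^ 2)) + max k.k13 0 * N ^ 3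

theorem dx_le_dxBound (k : QuarticCoeffs) {M N x y : ℝ} (hx : x ∈ Icc 0 M) (hy : y ∈ Icc 0 N) :
    k.dx (x, y) ≤ k.dxBound M N := by
  have key : ∀ c m m' : ℝ, 0 ≤ m → m ≤ m' → c * m ≤ max c 0 * m' := fun c m m' h0 h1 =>
    (mul_le_mul_of_nonneg_right (le_max_left c 0) h0).trans
      (mul_le_mul_of_nonneg_left h1 (le_max_right c 0))
  obtain ⟨hx0, hxM⟩ := hx
  obtain ⟨hy0, hyN⟩ := hy
  have hM := hx0.trans hxM
  have hN := hy0.trans hyN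
  have h1 := key k.k20 x M hx0 hxM
  have h2 := key k.k11 y N hy0 hyN
  have h3 := key k.k30 (x ^ 2) (M ^ 2) (by positivity) (by gcongr)
  have h4 := key k.k21 (x * y) (M * N) (by positivity) (by gcongr)
  have h5 := key k.k12 (y ^ 2) (N ^ 2) (by positivity) (by gcongr)
  have h6 := key k.k40 (x ^ 3) (M ^ 3) (by positivity) (by gcongr)
  have h7 := key k.k31 (x ^ 2 * y) (M ^ 2 * N) (by positivity) (by gcongr)
  have h8 := key k.k22 (x * y ^ 2) (M * N ^ 2) (by positivity) (by gcongr)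
  have h9 := key k.k13 (y ^ 3) (N ^ 3) (by positivity) (by gcongr)
  unfold dx dxBound
  simp only
  linarith

/-- The reflection of the polynomial in the diagonal. -/
def swap (k : QuarticCoeffs) : QuarticCoeffs :=
  { k10 := k.k01, k01 := k.k10, k20 := k.k02, k11 := k.k11, k02 := k.k20, k30 := k.k03,
    k21 := k.k12, k12 := k.k21, k03 := k.k30, k40 := k.k04, k31 := k.k13, k22 := k.k22,
    k13 := k.k31, k04 := k.k40 }

theorem dx_swap (k : QuarticCoeffs) (x y : ℝ) : k.swap.dx (y, x) = k.dy (x, y) := by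
  simp only [dx, dy, swap]
  ring

end QuarticCoeffs

/-- Four sign changes in the values give four roots beyond `t₀`, and by Descartes' rule of signs
there are no other positive roots. -/
theorem exists_four_roots {k : QuarticCoeffs} {σ : Fin 8 → SignType}
    (hσ : ∀ i, SignType.sign (k.crossCoeff i) = σ i) (h7 : σ 7 ≠ 0)
    (hvar : ((((List.ofFn σ).reverse.filter (· ≠ 0)).destutter (· ≠ ·)).length - 1) ≤ 4)
    {t₀ t₁ t₂ t₃ t₄ : ℝ} (ht₀ : 0 < t₀) (h₀₁ : t₀ < t₁) (h₁₂ : t₁ < t₂) (h₂₃ : t₂ < t₃)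
    (h₃₄ : t₃ < t₄) (e₀ : 0 < k.crossEval t₀) (e₁ : k.crossEval t₁ < 0)
    (e₂ : 0 < k.crossEval t₂) (e₃ : k.crossEval t₃ < 0) (e₄ : 0 < k.crossEval t₄) :
    ∃ S : Finset ℝ, S.card = 4 ∧ (∀ s ∈ S, t₀ < s) ∧
      ∀ s, 0 < s → (s ∈ S ↔ k.crossEval s = 0) := by
  have hc : Continuous k.crossEval := by
    unfold QuarticCoeffs.crossEval
    fun_prop
  obtain ⟨s₁, hs₁, r₁⟩ := intermediate_value_Ioo' h₀₁.le hc.continuousOn ⟨e₁, e₀⟩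
  obtain ⟨s₂, hs₂, r₂⟩ := intermediate_value_Ioo h₁₂.le hc.continuousOn ⟨e₁, e₂⟩
  obtain ⟨s₃, hs₃, r₃⟩ := intermediate_value_Ioo' h₂₃.le hc.continuousOn ⟨e₃, e₂⟩
  obtain ⟨s₄, hs₄, r₄⟩ := intermediate_value_Ioo h₃₄.le hc.continuousOn ⟨e₃, e₄⟩
  have l₁ := hs₁.2.trans hs₂.1
  have l₂ := hs₂.2.trans hs₃.1
  have l₃ := hs₃.2.trans hs₄.1
  have hmem : ∀ s ∈ ({s₁, s₂, s₃, s₄} : Finset ℝ), t₀ < s ∧ k.crossEval s = 0 := by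
    intro s hs
    simp only [Finset.mem_insert, Finset.mem_singleton] at hs
    rcases hs with rfl | rfl | rfl | rfl
    · exact ⟨hs₁.1, r₁⟩
    · exact ⟨hs₁.1.trans l₁, r₂⟩
    · exact ⟨(hs₁.1.trans l₁).trans l₂, r₃⟩
    · exact ⟨((hs₁.1.trans l₁).trans l₂).trans l₃, r₄⟩
  have hcard : ({s₁, s₂, s₃, s₄} : Finset ℝ).card = 4 := by
    simp [l₁.ne, l₂.ne, l₃.ne, (l₁.trans l₂).ne, (l₂.trans l₃).ne, ((l₁.trans l₂).trans l₃).ne]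
  refine ⟨{s₁, s₂, s₃, s₄}, hcard, fun s hs => (hmem s hs).1, fun s hs => ⟨fun h => (hmem s h).2,
    fun h => ?_⟩⟩
  by_contra hnot
  have := card_pos_roots_le hσ h7 (S := insert s {s₁, s₂, s₃, s₄}) (by
    intro r hr
    rcases Finset.mem_insert.1 hr with rfl | hr
    · exact ⟨hs, h⟩
    · exact ⟨ht₀.trans (hmem r hr).1, (hmem r hr).2⟩)
  rw [Finset.card_insert_of_notMem hnot, hcard] at this
  omega

/-- A criterion for exactly four crossing limit cycles with the center `ẋ = -y`, `ẏ = x + 1 / 2`: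
four sign changes in the coefficients and four sign changes in the values of the polynomial that
describes the common levels of the first integrals, and a field which points to the upper left on
a rectangle that contains all candidates. -/
theorem encard_limitCycles_eq_four {k : QuarticCoeffs} (σ : Fin 8 → SignType)
    (hσ : ∀ i, SignType.sign (k.crossCoeff i) = σ i) (h7 : σ 7 ≠ 0)
    (hvar : ((((List.ofFn σ).reverse.filter (· ≠ 0)).destutter (· ≠ ·)).length - 1) ≤ 4)
    (t₀ t₁ t₂ t₃ t₄ : ℝ) (ht₀ : 0 < t₀) (h₀₁ : t₀ < t₁) (h₁₂ : t₁ < t₂) (h₂₃ : t₂ < t₃)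
    (h₃₄ : t₃ < t₄) (e₀ : 0 < k.crossEval t₀) (e₁ : k.crossEval t₁ < 0)
    (e₂ : 0 < k.crossEval t₂) (e₃ : k.crossEval t₃ < 0) (e₄ : 0 < k.crossEval t₄)
    (hdx : k.dxBound (1 / ((1 + t₀) ^ 2 - 1)) ((1 + t₀) / ((1 + t₀) ^ 2 - 1)) < 0)
    (hdy : k.swap.dxBound ((1 + t₀) / ((1 + t₀) ^ 2 - 1)) (1 / ((1 + t₀) ^ 2 - 1)) < 0) :
    {Γ | IsCrossingLimitCycle (linearCenter 0 0 (1 / 2) 1) k.field Γ}.encard = 4 := by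
  obtain ⟨S, hcard, hSt, hS⟩ := exists_four_roots hσ h7 hvar ht₀ h₀₁ h₁₂ h₂₃ h₃₄ e₀ e₁ e₂ e₃ e₄
  have hw : ∀ s : ℝ, 0 < s → 0 < (1 + s) ^ 2 - 1 := fun s hs => by nlinarith
  set ψ : ℝ → ℝ × ℝ := fun s => (1 / ((1 + s) ^ 2 - 1), (1 + s) / ((1 + s) ^ 2 - 1)) with hψ
  have hX : linearCenter 0 0 (1 / 2) 1 = QuarticCoeffs.field
      { k10 := -1 * (1 / 2), k01 := 1 * 0, k20 := -1 / 2, k11 := -1 * 0,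
        k02 := -1 * ((0 : ℝ) ^ 2 + 1 ^ 2) / 2 } := by
    rw [← linearCenter_eq_field, one_smul]
  have hXl : LocallyLipschitz (linearCenter 0 0 (1 / 2) 1) := by
    rw [hX]
    exact QuarticCoeffs.locallyLipschitz _
  have hXH : IsHamiltonian (linearCenter 0 0 (1 / 2) 1) _ := hX ▸ QuarticCoeffs.isHamiltonian _
  have hinj : InjOn ψ S := by
    intro s hs t ht hst
    have hs0 := ht₀.trans (hSt s hs)
    have ht0 := ht₀.trans (hSt t ht)
    have h1 : 1 / ((1 + s) ^ 2 - 1) = 1 / ((1 + t) ^ 2 - 1) := congrArg Prod.fst hst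
    have h2 : (1 + s) / ((1 + s) ^ 2 - 1) = (1 + t) / ((1 + t) ^ 2 - 1) := congrArg Prod.snd hst
    rw [← mul_one_div, ← mul_one_div (1 + t), h1] at h2
    have := mul_right_cancel₀ (one_div_pos.2 (hw t ht0)).ne' h2
    linarith
  have hmain := encard_limitCycles_eq (A := S.image ψ) hXl k.locallyLipschitz (fun z => ?_)
  · rw [hmain, Finset.card_image_of_injOn hinj, hcard]
    rfl
  rw [Finset.mem_image]
  constructor
  · rintro ⟨s, hs, rfl⟩
    have hts := hSt s hs
    have hs0 := ht₀.trans hts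
    have hws := hw s hs0
    have hwt := hw t₀ ht₀
    have hx : 0 < (ψ s).1 := one_div_pos.2 hws
    have hy : 0 < (ψ s).2 := div_pos (by linarith) hws
    have hxM : (ψ s).1 ≤ 1 / ((1 + t₀) ^ 2 - 1) :=
      one_div_le_one_div_of_le hwt (by nlinarith)
    have hyN : (ψ s).2 ≤ (1 + t₀) / ((1 + t₀) ^ 2 - 1) := by
      rw [hψ]
      simp only
      rw [div_le_div_iff₀ hws hwt]
      nlinarith [mul_pos (sub_pos.2 hts) (by positivity : 0 < 1 + (1 + s) * (1 + t₀))]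
    have hlevel : k.ham ((ψ s).1, 0) = k.ham (0, (ψ s).2) := by
      have h := (hS s hs0).1 hs
      rw [k.crossEval_eq hs0] at h
      exact sub_eq_zero.1 ((mul_eq_zero.1 h).resolve_left (pow_ne_zero 4 hws.ne'))
    have hcircle : (ψ s).1 ^ 2 + (ψ s).1 = (ψ s).2 ^ 2 := by
      simp only [hψ]
      field_simp
      ring
    have hb : ∀ x ∈ Icc 0 (ψ s).1, ∀ y ∈ Icc 0 (ψ s).2,
        (k.field (x, y)).1 < 0 ∧ 0 < (k.field (x, y)).2 := fun x hx' y hy' =>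
      have hxI : x ∈ Icc 0 (1 / ((1 + t₀) ^ 2 - 1)) := ⟨hx'.1, hx'.2.trans hxM⟩
      have hyI : y ∈ Icc 0 ((1 + t₀) / ((1 + t₀) ^ 2 - 1)) := ⟨hy'.1, hy'.2.trans hyN⟩
      ⟨(k.dx_swap x y).symm.trans_lt ((k.swap.dx_le_dxBound hyI hxI).trans_lt hdy),
        neg_pos.2 ((k.dx_le_dxBound hxI hyI).trans_lt hdx)⟩
    obtain ⟨S₁, hS₁⟩ := exists_isArc_of_monotone k.locallyLipschitz k.isHamiltonian hx hy hlevel hb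
    obtain ⟨S₂, hS₂⟩ := exists_isArc_circle hx hy hcircle
    refine ⟨S₁ ∪ S₂, S₁, S₂, ⟨hx, rfl, ?_⟩, ⟨rfl, hy, ?_⟩, Or.inl ⟨hS₁, hS₂⟩, rfl⟩
    · refine mul_pos ?_ (hb _ ⟨hx.le, le_rfl⟩ 0 ⟨le_rfl, hy.le⟩).2
      simp only [linearCenter]
      linarith
    · refine mul_pos_of_neg_of_neg ?_ (hb 0 ⟨le_rfl, hx.le⟩ _ ⟨hy.le, le_rfl⟩).1
      simp only [linearCenter]
      linarith
  · rintro ⟨Γ, h⟩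
    obtain ⟨x, y⟩ := z
    have hx : 0 < x := h.fst_pos
    have hy : 0 < y := h.snd_pos
    obtain ⟨h1, h2⟩ := h.mem_matchSet hXH k.isHamiltonian
    simp only at h1 h2
    have hcircle : x ^ 2 + x = y ^ 2 := by
      simp [QuarticCoeffs.ham] at h2
      linarith
    have hxy : x < y := by nlinarith
    have hs0 : 0 < y / x - 1 := sub_pos.2 ((one_lt_div hx).2 hxy)
    have hwx : (1 + (y / x - 1)) ^ 2 - 1 = 1 / x := by
      field_simp
      linarith
    have hψx : ψ (y / x - 1) = (x, y) := by
      rw [hψ]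
      simp only [hwx]
      refine Prod.ext ?_ ?_
      · simp
      · field_simp
        ring
    refine ⟨y / x - 1, (hS _ hs0).2 ?_, hψx⟩
    have hψ1 := congrArg Prod.fst hψx
    have hψ2 := congrArg Prod.snd hψx
    simp only [hψ] at hψ1 hψ2
    rw [k.crossEval_eq hs0, hψ1, hψ2, h1, sub_self, mul_zero]

/-! ### Four limit cycles in each of the ten classes

For each class the values of the parameters come from the four equations `k.crossEval s = 0` at
four prescribed values of `s`, solved numerically and rounded. The center `ẋ = -y`, `ẏ = x + 1 / 2`
is the same for all classes. -/

theorem exists_four_limitCycles_N1 : ∃ Y, InClass .N1 Y ∧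
    {Γ | IsCrossingLimitCycle (linearCenter 0 0 (1 / 2) 1) Y Γ}.encard = 4 := by
  refine ⟨_, ⟨_, -34, -118, -4, 60, -102, -3, ⟨16800, -19400, by norm_num, rfl⟩,
    by norm_num, rfl⟩, ?_⟩
  rw [show affineChange (-34) (-118) (-4) 60 (-102) (-3)
      (field1 16800 (-19400)) = QuarticCoeffs.field
      { k10 := -19573768 / 255789, k01 := -223636 / 255789, k20 := -627499064 / 85263,
        k11 := -4159456 / 85263, k02 := -2703956 / 85263, k30 := -39304 / 2637,
        k21 := -136408 / 879, k12 := -473416 / 879, k03 := -1643032 / 2637, k40 := -83521 / 2637,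
        k31 := -1159468 / 2637, k22 := -2012018 / 879, k13 := -13965772 / 2637,
        k04 := -12117361 / 2637 } by
    ext p <;> simp only [affineChange, field1, QuarticCoeffs.field, QuarticCoeffs.dx,
      QuarticCoeffs.dy] <;> ring]
  refine encard_limitCycles_eq_four ![1, 1, 1, -1, -1, 1, -1, 1] ?_ (by decide) (by decide)
    (5 / 2) (13 / 5) (21 / 4) (21 / 2) 31 ?_ ?_ ?_ ?_ ?_ ?_ ?_ ?_ ?_ ?_ ?_ ?_
  · intro i
    fin_cases i <;> norm_num [QuarticCoeffs.crossCoeff]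
  all_goals norm_num [QuarticCoeffs.crossEval_expand,
    QuarticCoeffs.dxBound, QuarticCoeffs.swap]

theorem exists_four_limitCycles_N2 : ∃ Y, InClass .N2 Y ∧
    {Γ | IsCrossingLimitCycle (linearCenter 0 0 (1 / 2) 1) Y Γ}.encard = 4 := by
  refine ⟨_, ⟨_, -265, -103, -35, 0, 349, 36, ⟨15100, 5900, by norm_num, by norm_num, rfl⟩,
    by norm_num, rfl⟩, ?_⟩
  rw [show affineChange (-265) (-103) (-35) 0 349 36
      (field2 15100 5900) = QuarticCoeffs.field
      { k10 := -55536800 / 20591, k01 := -18862885 / 1091323, k20 := -361213550 / 20591,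
        k11 := -45540245 / 20591, k02 := -2285859931 / 1091323, k30 := -2528100 / 349,
        k21 := -12658785 / 349, k12 := -8694642 / 349, k03 := -428104977 / 92485, k31 := -70225,
        k22 := -81885, k13 := -31827, k04 := -1092727 / 265 } by
    ext p <;> simp only [affineChange, field2, QuarticCoeffs.field, QuarticCoeffs.dx,
      QuarticCoeffs.dy] <;> ring]
  refine encard_limitCycles_eq_four ![1, 1, -1, -1, 1, 1, -1, 1] ?_ (by decide) (by decide)
    1 (11 / 10) (19 / 10) (24 / 5) 25 ?_ ?_ ?_ ?_ ?_ ?_ ?_ ?_ ?_ ?_ ?_ ?_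
  · intro i
    fin_cases i <;> norm_num [QuarticCoeffs.crossCoeff]
  all_goals norm_num [QuarticCoeffs.crossEval_expand,
    QuarticCoeffs.dxBound, QuarticCoeffs.swap]

theorem exists_four_limitCycles_N31 : ∃ Y, InClass .N31 Y ∧
    {Γ | IsCrossingLimitCycle (linearCenter 0 0 (1 / 2) 1) Y Γ}.encard = 4 := by
  refine ⟨_, ⟨_, -32, -66, -50, 95, 26, 28, ⟨-3800, by norm_num, rfl⟩,
    by norm_num, rfl⟩, ?_⟩
  rw [show affineChange (-32) (-66) (-50) 95 26 28
      (field3 0 0 (-3800)) = QuarticCoeffs.field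
      { k10 := -7773880 / 2719, k01 := -55424 / 2719, k20 := -24012487 / 2719,
        k11 := -34657092 / 2719, k02 := -6500340 / 2719, k30 := -13742510 / 2719,
        k21 := -64646418 / 2719, k12 := -45371208 / 2719, k03 := -7856888 / 2719,
        k40 := 26001025 / 21752, k31 := -21239245 / 2719, k22 := -41078088 / 2719,
        k13 := -17445688 / 2719, k04 := -2151370 / 2719 } by
    ext p <;> simp only [affineChange, field3, QuarticCoeffs.field, QuarticCoeffs.dx,
      QuarticCoeffs.dy] <;> ring]
  refine encard_limitCycles_eq_four ![1, -1, -1, -1, 1, 1, -1, 1] ?_ (by decide) (by decide)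
    (1 / 2) (11 / 20) (13 / 10) 5 (27 / 2) ?_ ?_ ?_ ?_ ?_ ?_ ?_ ?_ ?_ ?_ ?_ ?_
  · intro i
    fin_cases i <;> norm_num [QuarticCoeffs.crossCoeff]
  all_goals norm_num [QuarticCoeffs.crossEval_expand,
    QuarticCoeffs.dxBound, QuarticCoeffs.swap]

theorem exists_four_limitCycles_N32 : ∃ Y, InClass .N32 Y ∧
    {Γ | IsCrossingLimitCycle (linearCenter 0 0 (1 / 2) 1) Y Γ}.encard = 4 := by
  refine ⟨_, ⟨_, 39, 109, 21, -93, -10, -29, ⟨-3400, -11100, by norm_num, by norm_num, rfl⟩,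
    by norm_num, rfl⟩, ?_⟩
  rw [show affineChange 39 109 21 (-93) (-10) (-29)
      (field3 (-3400) (-11100) 0) = QuarticCoeffs.field
      { k10 := -32437121 / 13357, k01 := -231811 / 40071, k20 := -1145632621 / 240426,
        k11 := -1000232047 / 360639, k02 := -4872106213 / 2163834, k30 := -378913 / 361,
        k21 := -4687075 / 361, k12 := -12859459 / 1083, k03 := -10994170 / 9747,
        k40 := -152799 / 1444, k31 := -3944471 / 361, k22 := -13095521 / 722,
        k13 := -11443430 / 3249, k04 := -1779650 / 9747 } by
    ext p <;> simp only [affineChange, field3, QuarticCoeffs.field, QuarticCoeffs.dx,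
      QuarticCoeffs.dy] <;> ring]
  refine encard_limitCycles_eq_four ![1, 1, -1, -1, 1, 1, -1, 1] ?_ (by decide) (by decide)
    (1 / 2) (11 / 20) (13 / 10) (39 / 10) 22 ?_ ?_ ?_ ?_ ?_ ?_ ?_ ?_ ?_ ?_ ?_ ?_
  · intro i
    fin_cases i <;> norm_num [QuarticCoeffs.crossCoeff]
  all_goals norm_num [QuarticCoeffs.crossEval_expand,
    QuarticCoeffs.dxBound, QuarticCoeffs.swap]

theorem exists_four_limitCycles_N41 : ∃ Y, InClass .N41 Y ∧
    {Γ | IsCrossingLimitCycle (linearCenter 0 0 (1 / 2) 1) Y Γ}.encard = 4 := by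
  refine ⟨_, ⟨_, 179, 1, 1, 18, 152, 5, ⟨12900, by norm_num, rfl⟩,
    by norm_num, rfl⟩, ?_⟩
  rw [show affineChange 179 1 1 18 152 5
      (field4 0 0 12900) = QuarticCoeffs.field
      { k10 := -465009 / 5438, k01 := -6851 / 5438, k20 := -415950567 / 54380,
        k11 := -3352713 / 27190, k02 := -1824207 / 54380, k30 := -4427109 / 13595,
        k21 := -38414148 / 13595, k12 := -9738927 / 13595, k03 := -8815316 / 13595,
        k40 := -1559817 / 2719, k31 := -26405298 / 2719, k22 := -112458039 / 2719,
        k13 := -7562760 / 2719, k04 := -13348336 / 2719 } by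
    ext p <;> simp only [affineChange, field4, QuarticCoeffs.field, QuarticCoeffs.dx,
      QuarticCoeffs.dy] <;> ring]
  refine encard_limitCycles_eq_four ![1, 1, 1, -1, -1, 1, -1, 1] ?_ (by decide) (by decide)
    3 (31 / 10) (47 / 10) 10 22 ?_ ?_ ?_ ?_ ?_ ?_ ?_ ?_ ?_ ?_ ?_ ?_
  · intro i
    fin_cases i <;> norm_num [QuarticCoeffs.crossCoeff]
  all_goals norm_num [QuarticCoeffs.crossEval_expand,
    QuarticCoeffs.dxBound, QuarticCoeffs.swap]

theorem exists_four_limitCycles_N42 : ∃ Y, InClass .N42 Y ∧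
    {Γ | IsCrossingLimitCycle (linearCenter 0 0 (1 / 2) 1) Y Γ}.encard = 4 := by
  refine ⟨_, ⟨_, 105, -108, 130, 287, 288, 146, ⟨30100, -7600, by norm_num, by norm_num, rfl⟩,
    by norm_num, rfl⟩, ?_⟩
  rw [show affineChange 105 (-108) 130 287 288 146
      (field4 30100 (-7600) 0) = QuarticCoeffs.field
      { k10 := -1923405049 / 27702, k01 := -21780014 / 10773, k20 := -46517980579 / 332424,
        k11 := -600472411 / 4617, k02 := -207133082 / 3591, k30 := -586453217 / 4374,
        k21 := -16177546 / 81, k12 := -803272 / 9, k03 := -502528 / 21,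
        k40 := -1747623073 / 34992, k31 := -26745817 / 243, k22 := -1093022 / 9,
        k13 := -339328 / 3, k04 := -362496 / 7 } by
    ext p <;> simp only [affineChange, field4, QuarticCoeffs.field, QuarticCoeffs.dx,
      QuarticCoeffs.dy] <;> ring]
  refine encard_limitCycles_eq_four ![1, -1, 1, 1, -1, -1, 1, 1] ?_ (by decide) (by decide)
    (3 / 20) (1 / 5) (1 / 2) (13 / 10) (17 / 10) ?_ ?_ ?_ ?_ ?_ ?_ ?_ ?_ ?_ ?_ ?_ ?_
  · intro i
    fin_cases i <;> norm_num [QuarticCoeffs.crossCoeff]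
  all_goals norm_num [QuarticCoeffs.crossEval_expand,
    QuarticCoeffs.dxBound, QuarticCoeffs.swap]

theorem exists_four_limitCycles_N51 : ∃ Y, InClass .N51 Y ∧
    {Γ | IsCrossingLimitCycle (linearCenter 0 0 (1 / 2) 1) Y Γ}.encard = 4 := by
  refine ⟨_, ⟨_, -183, -199, -201, 134, -126, -128, ⟨-16000, -4 / 25, by norm_num, rfl⟩,
    by norm_num, rfl⟩, ?_⟩
  rw [show affineChange (-183) (-199) (-201) 134 (-126) (-128)
      (field5 0 0 (-16000) (-4 / 25)) = QuarticCoeffs.field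
      { k10 := -6109534427 / 248620, k01 := -2111189847 / 1243100, k20 := -81008056059 / 2486200,
        k11 := -119780031723 / 1243100, k02 := -38197436699 / 2486200,
        k30 := -7492462667 / 248620, k21 := -93540964437 / 1243100,
        k12 := -132926622213 / 1243100, k03 := -17914298151 / 1243100,
        k40 := -5545496009 / 4972400, k31 := -37006745913 / 1243100,
        k22 := -92685171579 / 2486200, k13 := -43840603929 / 1243100,
        k04 := -17815864201 / 4972400 } by
    ext p <;> simp only [affineChange, field5, QuarticCoeffs.field, QuarticCoeffs.dx,
      QuarticCoeffs.dy] <;> ring]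
  refine encard_limitCycles_eq_four ![1, -1, 1, 1, -1, -1, 1, 1] ?_ (by decide) (by decide)
    (1 / 5) (1 / 4) (1 / 2) 1 (11 / 5) ?_ ?_ ?_ ?_ ?_ ?_ ?_ ?_ ?_ ?_ ?_ ?_
  · intro i
    fin_cases i <;> norm_num [QuarticCoeffs.crossCoeff]
  all_goals norm_num [QuarticCoeffs.crossEval_expand,
    QuarticCoeffs.dxBound, QuarticCoeffs.swap]

theorem exists_four_limitCycles_N52 : ∃ Y, InClass .N52 Y ∧
    {Γ | IsCrossingLimitCycle (linearCenter 0 0 (1 / 2) 1) Y Γ}.encard = 4 := by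
  refine ⟨_, ⟨_, 99, -121, -3, -212, -213, -7, ⟨-25200, 14300, -1 / 5, by norm_num, by norm_num, rfl⟩,
    by norm_num, rfl⟩, ?_⟩
  rw [show affineChange 99 (-121) (-3) (-212) (-213) (-7)
      (field5 (-25200) 14300 0 (-1 / 5)) = QuarticCoeffs.field
      { k10 := -620293602 / 3038035, k01 := -5386014 / 3038035, k20 := -69600577766 / 3038035,
        k11 := -370028082 / 3038035, k02 := -268095579 / 3038035, k30 := -50232559 / 33385,
        k21 := -122494428 / 33385, k12 := -155869026 / 33385, k03 := -60935502 / 33385,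
        k40 := -12262494539 / 934780, k31 := -2089411311 / 46739, k22 := -12625246878 / 233695,
        k13 := -2294659350 / 46739, k04 := -6602710787 / 467390 } by
    ext p <;> simp only [affineChange, field5, QuarticCoeffs.field, QuarticCoeffs.dx,
      QuarticCoeffs.dy] <;> ring]
  refine encard_limitCycles_eq_four ![1, 1, 1, -1, -1, 1, -1, 1] ?_ (by decide) (by decide)
    (19 / 10) 2 (13 / 2) (45 / 4) 44 ?_ ?_ ?_ ?_ ?_ ?_ ?_ ?_ ?_ ?_ ?_ ?_
  · intro i
    fin_cases i <;> norm_num [QuarticCoeffs.crossCoeff]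
  all_goals norm_num [QuarticCoeffs.crossEval_expand,
    QuarticCoeffs.dxBound, QuarticCoeffs.swap]

theorem exists_four_limitCycles_N61 : ∃ Y, InClass .N61 Y ∧
    {Γ | IsCrossingLimitCycle (linearCenter 0 0 (1 / 2) 1) Y Γ}.encard = 4 := by
  refine ⟨_, ⟨_, 66, 93, 58, -40, 12, 78, ⟨12400, -21 / 25, by norm_num, rfl⟩,
    by norm_num, rfl⟩, ?_⟩
  rw [show affineChange 66 93 58 (-40) 12 78
      (field6 0 0 12400 (-21 / 25)) = QuarticCoeffs.field
      { k10 := -2375509 / 1175, k01 := -1913 / 94, k20 := -21773304 / 1175,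
        k11 := -27609216 / 1175, k02 := -1620498 / 1175, k30 := -3176759 / 470,
        k21 := -154935333 / 4700, k12 := -309757473 / 9400, k03 := -4071591 / 752,
        k40 := 849503 / 1128, k31 := -1352027 / 940, k22 := -222835329 / 18800,
        k13 := -255220479 / 18800, k04 := -571240323 / 150400 } by
    ext p <;> simp only [affineChange, field6, QuarticCoeffs.field, QuarticCoeffs.dx,
      QuarticCoeffs.dy] <;> ring]
  refine encard_limitCycles_eq_four ![1, 1, -1, -1, 1, 1, -1, 1] ?_ (by decide) (by decide)
    1 (11 / 10) (8 / 5) (15 / 2) 19 ?_ ?_ ?_ ?_ ?_ ?_ ?_ ?_ ?_ ?_ ?_ ?_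
  · intro i
    fin_cases i <;> norm_num [QuarticCoeffs.crossCoeff]
  all_goals norm_num [QuarticCoeffs.crossEval_expand,
    QuarticCoeffs.dxBound, QuarticCoeffs.swap]

theorem exists_four_limitCycles_N62 : ∃ Y, InClass .N62 Y ∧
    {Γ | IsCrossingLimitCycle (linearCenter 0 0 (1 / 2) 1) Y Γ}.encard = 4 := by
  refine ⟨_, ⟨_, 82, 255, 152, 288, 147, 52, ⟨-14000, 13900, -91 / 100, by norm_num, by norm_num, rfl⟩,
    by norm_num, rfl⟩, ?_⟩
  rw [show affineChange 82 255 152 288 147 52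
      (field6 (-14000) 13900 0 (-91 / 100)) = QuarticCoeffs.field
      { k10 := -11213495776 / 1640895, k01 := -285989496 / 2734825,
        k20 := -5878976424076 / 106658175, k11 := -2552894676508 / 35552725,
        k02 := -163251556644 / 35552725, k30 := -4428105568 / 153465,
        k21 := -45099920298 / 255775, k12 := -40932451152 / 255775, k03 := -1596588867 / 102310,
        k40 := 12124352882 / 767325, k31 := -7749274108 / 255775, k22 := -150824403999 / 1023100,
        k13 := -21581452989 / 204620, k04 := -1984522815 / 163696 } by
    ext p <;> simp only [affineChange, field6, QuarticCoeffs.field, QuarticCoeffs.dx,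
      QuarticCoeffs.dy] <;> ring]
  refine encard_limitCycles_eq_four ![1, 1, -1, -1, 1, 1, -1, 1] ?_ (by decide) (by decide)
    (17 / 20) (9 / 10) (27 / 10) (27 / 4) (17 / 2) ?_ ?_ ?_ ?_ ?_ ?_ ?_ ?_ ?_ ?_ ?_ ?_
  · intro i
    fin_cases i <;> norm_num [QuarticCoeffs.crossCoeff]
  all_goals norm_num [QuarticCoeffs.crossEval_expand,
    QuarticCoeffs.dxBound, QuarticCoeffs.swap]

end NilpotentPiecewise

theorem theorem1 :
    (∀ (s : NilpotentPiecewise.SaddleClass) (κ A B C ω : ℝ) (Y : NilpotentPiecewise.PlaneField),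
      κ ≠ 0 → 0 < ω → NilpotentPiecewise.InClass s Y →
      {Γ : Set (ℝ × ℝ) | NilpotentPiecewise.IsCrossingLimitCycle
        (κ • NilpotentPiecewise.linearCenter A B C ω) Y Γ}.encard ≤ 7) ∧
    (∀ s : NilpotentPiecewise.SaddleClass, ∃ (A B C ω : ℝ) (Y : NilpotentPiecewise.PlaneField),
      0 < ω ∧ NilpotentPiecewise.InClass s Y ∧
      {Γ : Set (ℝ × ℝ) | NilpotentPiecewise.IsCrossingLimitCycle
        (NilpotentPiecewise.linearCenter A B C ω) Y Γ}.encard = 4) := by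
  refine ⟨fun s κ A B C ω Y hκ hω hY => NilpotentPiecewise.encard_limitCycles_le_seven hκ hω hY,
    fun s => ?_⟩
  suffices h : ∃ Y, NilpotentPiecewise.InClass s Y ∧
      {Γ | NilpotentPiecewise.IsCrossingLimitCycle
        (NilpotentPiecewise.linearCenter 0 0 (1 / 2) 1) Y Γ}.encard = 4 by
    obtain ⟨Y, hY, hcard⟩ := h
    exact ⟨0, 0, 1 / 2, 1, Y, one_pos, hY, hcard⟩
  cases s
  · exact NilpotentPiecewise.exists_four_limitCycles_N1
  · exact NilpotentPiecewise.exists_four_limitCycles_N2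
  · exact NilpotentPiecewise.exists_four_limitCycles_N31
  · exact NilpotentPiecewise.exists_four_limitCycles_N32
  · exact NilpotentPiecewise.exists_four_limitCycles_N41
  · exact NilpotentPiecewise.exists_four_limitCycles_N42
  · exact NilpotentPiecewise.exists_four_limitCycles_N51
  · exact NilpotentPiecewise.exists_four_limitCycles_N52
  · exact NilpotentPiecewise.exists_four_limitCycles_N61
  · exact NilpotentPiecewise.exists_four_limitCycles_N62
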